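/- Let $p>1$, $f,g,\rho\in C[0,1]$ and $d\in C^1(0,1)$ satisfy $$\rho>0\ \text{in }(0,1),\quad \rho(0)=\rho(1)=0,\qquad g(0)>0,\quad \int_0^u g(s)\,ds>0\ \text{ for every }u\in(0,1],\qquad d>0\ \text{in }(0,1),\quad \rho\, d^{\frac1{p-1}}\in L^1(0,1).$$ A travelling wave solution with speed $c\in\mathbb R$ of the equation $f(u)u_x+g(u)u_\tau=[d(u)|u_x|^{p-2}u_x]_x+\rho(u)$ is a function $u\in C^1(\alpha,\beta)$ on an open interval $(\alpha,\beta)$, $-\infty\le\alpha<\beta\le+\infty$, with $0<u<1$ and $d(u)|u'|^{p-2}u'\in C^1(\alpha,\beta)$ (this product is read as $0$ where $u'=0$), such that $$(d(u)|u'|^{p-2}u')'+(c\,g(u)-f(u))u'+\rho(u)=0\ \text{ in }(\alpha,\beta),$$ $u(\alpha^+)=1$, $u(\beta^-)=0$, and $d(u)|u'|^{p-2}u'\to 0$ as $t\to\alpha^+$ and as $t\to\beta^-$. Assume that the limit $$\ell_0:=\lim_{u\to0^+}\rho(u)\,\frac{d(u)^{\frac1{p-1}}}{u^{\frac1{p-1}}}$$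 exists and is finite, and let $c^*$ be the infimum of the speeds $c$ for which a travelling wave solution exists. Then $c^*$ is a real number, a travelling wave solution with speed $c$ exists if and only if $c\ge c^*$, and for every $k\in\mathbb R$ the following hold. (a) If $f(u)\ge k\,g(u)$ in a right neighbourhood of $0$, then $c^*>k$. (b) If for every $u\in(0,1)$ we have $k\,g(u)\ge f(u)$ and $$(k\,g(u)-f(u))^{p-1}\int_0^u (k\,g(s)-f(s))\,ds\ \ge\ \frac{p^p}{(p-1)^{p-1}}\,d(u)\,\rho(u)^{p-1},$$ then $c^*\le k$. (c) If there are $\delta\in(0,1]$ and $\ell<\frac{p^p}{(p-1)^{p-1}}$ such that for every $u\in(0,\delta)$ we have $k\,g(u)\ge f(u)$ and $$(k\,g(u)-f(u))^{p-1}\int_0^u (k\,g(s)-f(s))\,ds\ \le\ \ell\, d(u)\,\rho(u)^{p-1},$$ then $c^*>k$. -/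

import Mathlib

open Set Filter Topology MeasureTheory

/-- The flux `d(u) |u'|^(p-2) u'` of a profile `u`. -/
noncomputable def flux (p : ℝ) (d : ℝ → ℝ) (u : ℝ → ℝ) (t : ℝ) : ℝ :=
  d (u t) * |deriv u t| ^ (p - 2) * deriv u t

/-- The open interval `(α, β) ⊆ ℝ`, whose endpoints may be infinite. -/
def openInterval (α β : EReal) : Set ℝ := {t : ℝ | α < (t : EReal) ∧ (t : EReal) < β}

/-- The filter of real `t → α⁺`, where `α` may be `-∞`. -/
noncomputable def rightOf (α : EReal) : Filter ℝ := comap (fun t : ℝ => (t : EReal)) (𝓝[>] α)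

/-- The filter of real `t → β⁻`, where `β` may be `+∞`. -/
noncomputable def leftOf (β : EReal) : Filter ℝ := comap (fun t : ℝ => (t : EReal)) (𝓝[<] β)

/-- `u`, restricted to `(α, β)`, is a travelling wave solution with speed `c` of
`f(u) u_x + g(u) u_τ = [d(u) |u_x|^(p-2) u_x]_x + ρ(u)`, connecting `1` to `0`. -/
structure IsTravellingWave (p : ℝ) (f g d ρ : ℝ → ℝ) (c : ℝ) (α β : EReal) (u : ℝ → ℝ) :
    Prop where
  lt : α < β
  contDiffOn : ContDiffOn ℝ 1 u (openInterval α β)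
  mem_Ioo : ∀ t ∈ openInterval α β, u t ∈ Ioo (0 : ℝ) 1
  contDiffOn_flux : ContDiffOn ℝ 1 (flux p d u) (openInterval α β)
  equation : ∀ t ∈ openInterval α β,
    deriv (flux p d u) t + (c * g (u t) - f (u t)) * deriv u t + ρ (u t) = 0
  tendsto_left : Tendsto u (rightOf α) (𝓝 1)
  tendsto_right : Tendsto u (leftOf β) (𝓝 0)
  flux_left : Tendsto (flux p d u) (rightOf α) (𝓝 0)
  flux_right : Tendsto (flux p d u) (leftOf β) (𝓝 0)

/-- The wave speed `c` is admissible: there is a travelling wave solution with speed `c`. -/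
def AdmissibleSpeed (p : ℝ) (f g d ρ : ℝ → ℝ) (c : ℝ) : Prop :=
  ∃ (α β : EReal) (u : ℝ → ℝ), IsTravellingWave p f g d ρ c α β u

/-- The threshold wave speed `c*`, the smallest admissible one. -/
noncomputable def thresholdSpeed (p : ℝ) (f g d ρ : ℝ → ℝ) : ℝ :=
  sInf {c : ℝ | AdmissibleSpeed p f g d ρ c}

/-!
A travelling wave is strictly decreasing, so minus its flux is a function `w` of the value
`u ∈ (0, 1)` of the wave. With `r = 1 / (p - 1)`, `h = c g - f` and `q = ρ dʳ` it solves the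
singular first-order equation `w' = h - q w⁻ʳ`, is positive, and vanishes at both ends.
Conversely, each such `w` gives back a wave by integrating `u' = -(w(u) / d(u))ʳ`.

For every `c` the equation has a positive solution on `(0, 1)` which vanishes at `1`, and this
solution lies below every positive subsolution. Hence `c` is admissible as soon as some positive
subsolution vanishes at `0`. Adding `(c' - c) ∫₀ᵘ g` to a solution gives a subsolution for
`c' ≥ c`, so the admissible speeds form an up-set. Since `w < ∫₀ᵘ (c g - f)`, they are bounded
below and `c g - f` is positive somewhere near `0`, which is (a).

Write `H' = h`. Subsolutions of the form `t H` are optimal at `t = r / (1 + r)`, which gives (b).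
For (c), if `h Hʳ ≤ κ q` near `0` then `w ≤ t H` improves to `w ≤ (1 - 1 / (κ tʳ)) H`; for the
least possible `t` this forces `κ` to be at least the constant of (b).
-/

/-- `w` is a positive solution on `I` of the singular equation `w' = h - q w⁻ʳ`. With
`r = 1 / (p - 1)`, `h = c g - f` and `q = ρ dʳ` it is solved by minus the flux of a travelling
wave, as a function of the value of the wave. -/
def IsProfileOn (r : ℝ) (h q w : ℝ → ℝ) (I : Set ℝ) : Prop :=
  ∀ x ∈ I, 0 < w x ∧ HasDerivAt w (h x - q x * w x ^ (-r)) x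

/-- `v` is a positive subsolution on `I` of `w' = h - q w⁻ʳ`. As the equation is solved backwards
from a final value, subsolutions lie above solutions. -/
def IsSubprofileOn (r : ℝ) (h q v : ℝ → ℝ) (I : Set ℝ) : Prop :=
  ∀ x ∈ I, 0 < v x ∧ DifferentiableAt ℝ v x ∧ deriv v x ≤ h x - q x * v x ^ (-r)

theorem IsProfileOn.mono {r : ℝ} {h q w : ℝ → ℝ} {I J : Set ℝ} (hw : IsProfileOn r h q w I)
    (hJI : J ⊆ I) : IsProfileOn r h q w J :=
  fun x hx => hw x (hJI hx)

theorem IsProfileOn.continuousOn {r : ℝ} {h q w : ℝ → ℝ} {I : Set ℝ}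
    (hw : IsProfileOn r h q w I) : ContinuousOn w I :=
  fun x hx => (hw x hx).2.continuousAt.continuousWithinAt

theorem IsProfileOn.isSubprofileOn {r : ℝ} {h q w : ℝ → ℝ} {I : Set ℝ}
    (hw : IsProfileOn r h q w I) : IsSubprofileOn r h q w I :=
  fun x hx => ⟨(hw x hx).1, (hw x hx).2.differentiableAt, (hw x hx).2.deriv.le⟩

theorem IsSubprofileOn.mono {r : ℝ} {h q v : ℝ → ℝ} {I J : Set ℝ}
    (hv : IsSubprofileOn r h q v I) (hJI : J ⊆ I) : IsSubprofileOn r h q v J :=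
  fun x hx => hv x (hJI hx)

theorem le_of_deriv_nonneg_of_pos {a b η : ℝ} {φ : ℝ → ℝ} (hη : 0 ≤ η)
    (hφ : ∀ x ∈ Icc a b, DifferentiableAt ℝ φ x)
    (hφ' : ∀ x ∈ Icc a b, 0 < φ x → 0 ≤ deriv φ x) (hb : φ b ≤ η) {x : ℝ} (hx : x ∈ Icc a b) :
    φ x ≤ η := by
  -- Time is reversed, so that `φ` starts below and cannot cross lines of positive slope.
  have hneg : ∀ t ∈ Icc (-b) (-a), -t ∈ Icc a b := fun t ht =>
    ⟨le_neg_of_le_neg ht.2, neg_le_of_neg_le ht.1⟩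
  have hderiv : ∀ t ∈ Icc (-b) (-a), HasDerivAt (fun t => φ (-t)) (-deriv φ (-t)) t :=
    fun t ht => by
      simpa [Function.comp_def] using (hφ _ (hneg t ht)).hasDerivAt.scomp t (hasDerivAt_neg t)
  have hline : ∀ ε : ℝ, 0 < ε → φ x ≤ η + ε * (1 + (b - x)) := by
    intro ε hε
    have hxb := image_le_of_deriv_right_lt_deriv_boundary (a := -b) (b := -a)
      (B := fun t => η + ε * (1 + (b + t))) (B' := fun _ => ε)
      (fun t ht => (hderiv t ht).continuousAt.continuousWithinAt)
      (fun t ht => (hderiv t (Ico_subset_Icc_self ht)).hasDerivWithinAt)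
      (by simpa using hb.trans (le_add_of_nonneg_right hε.le))
      (fun t => by
        simpa using (((hasDerivAt_id t).const_add b).const_add 1).const_mul ε |>.const_add η)
      (fun t ht heq => by
        have hpos : 0 < φ (-t) := by
          rw [heq]
          have : 0 ≤ b + t := by linarith [ht.1]
          positivity
        linarith [hφ' _ (hneg t (Ico_subset_Icc_self ht)) hpos])
      (x := -x) ⟨neg_le_neg hx.2, neg_le_neg hx.1⟩
    simpa [sub_eq_add_neg] using hxb
  refine le_of_forall_pos_le_add fun ε hε => ?_
  have hxb : 0 < 1 + (b - x) := by linarith [hx.2]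
  simpa [div_mul_cancel₀ _ hxb.ne'] using hline (ε / (1 + (b - x))) (div_pos hε hxb)

theorem IsProfileOn.le_add_of_isSubprofileOn {a b r η : ℝ} {h q v w : ℝ → ℝ} (hr : 0 ≤ r)
    (hη : 0 ≤ η) (hq : ∀ x ∈ Icc a b, 0 ≤ q x) (hw : IsProfileOn r h q w (Icc a b))
    (hv : IsSubprofileOn r h q v (Icc a b)) (hb : w b ≤ v b + η) {x : ℝ} (hx : x ∈ Icc a b) :
    w x ≤ v x + η := by
  suffices w x - v x ≤ η by linarith
  refine le_of_deriv_nonneg_of_pos (φ := fun x => w x - v x) hη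
    (fun y hy => (hw y hy).2.differentiableAt.sub (hv y hy).2.1) (fun y hy hpos => ?_)
    (by linarith) hx
  obtain ⟨hvy, hdv, hv'⟩ := hv y hy
  have hanti : q y * w y ^ (-r) ≤ q y * v y ^ (-r) :=
    mul_le_mul_of_nonneg_left
      (Real.rpow_le_rpow_of_nonpos hvy (sub_pos.1 hpos).le (neg_nonpos.2 hr)) (hq y hy)
  rw [((hw y hy).2.fun_sub hdv.hasDerivAt).deriv]
  linarith

theorem exists_hasDerivAt_of_lipschitzWith {E : Type*} [NormedAddCommGroup E] [NormedSpace ℝ E]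
    [CompleteSpace E] {v : ℝ → E → E} {a b t₀ : ℝ} {K L : NNReal} (ht₀ : t₀ ∈ Icc a b)
    (hlip : ∀ t ∈ Icc a b, LipschitzWith K (v t))
    (hcont : ∀ x, ContinuousOn (fun t => v t x) (Icc a b))
    (hbound : ∀ t ∈ Icc a b, ∀ x, ‖v t x‖ ≤ L) (x₀ : E) :
    ∃ w : ℝ → E, w t₀ = x₀ ∧ ∀ t ∈ Ioo a b, HasDerivAt w (v t (w t)) t := by
  have hPL : IsPicardLindelof v ⟨t₀, ht₀⟩ x₀ (L * (b - a).toNNReal) 0 L K :=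
    { lipschitzOnWith := fun t ht => (hlip t ht).lipschitzOnWith
      continuousOn := fun x _ => hcont x
      norm_le := fun t ht x _ => hbound t ht x
      mul_max_le := by
        have hab : a ≤ b := ht₀.1.trans ht₀.2
        rw [NNReal.coe_mul, Real.coe_toNNReal _ (sub_nonneg.2 hab), NNReal.coe_zero, sub_zero]
        exact mul_le_mul_of_nonneg_left
          (max_le (sub_le_sub_left ht₀.1 b) (sub_le_sub_right ht₀.2 a)) L.coe_nonneg }
  obtain ⟨w, hw₀, hw⟩ := hPL.exists_eq_forall_mem_Icc_hasDerivWithinAt₀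
  exact ⟨w, hw₀, fun t ht =>
    (hw t (Ioo_subset_Icc_self ht)).hasDerivAt (Icc_mem_nhds ht.1 ht.2)⟩

theorem lipschitzWith_max_rpow_neg {r ε : ℝ} (hr : 0 ≤ r) (hε : 0 < ε) :
    LipschitzWith (r * ε ^ (-r - 1)).toNNReal (fun x : ℝ => max x ε ^ (-r)) := by
  have hIci : LipschitzOnWith (r * ε ^ (-r - 1)).toNNReal (fun x : ℝ => x ^ (-r)) (Ici ε) := by
    refine (convex_Ici ε).lipschitzOnWith_of_nnnorm_hasDerivWithin_le
      (fun x hx => (Real.hasDerivAt_rpow_const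
        (Or.inl (hε.trans_le hx).ne')).hasDerivWithinAt) (fun x hx => ?_)
    have hx₀ : 0 < x := hε.trans_le hx
    rw [← NNReal.coe_le_coe, coe_nnnorm, Real.coe_toNNReal _ (by positivity), norm_mul,
      norm_neg, Real.norm_of_nonneg hr, Real.norm_of_nonneg (by positivity)]
    exact mul_le_mul_of_nonneg_left (Real.rpow_le_rpow_of_nonpos hε hx (by linarith)) hr
  simpa [Function.comp_def] using hIci.comp (LipschitzWith.id.max_const ε).lipschitzOnWith
    (s := univ) (fun x _ => le_max_right x ε)

theorem eventually_le_mul_rpow_neg {r q₀ : ℝ} (hr : 0 < r) (hq₀ : 0 < q₀) (K : ℝ) :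
    ∀ᶠ ε in 𝓝[>] (0 : ℝ), K ≤ q₀ * ε ^ (-r) :=
  ((tendsto_rpow_neg_nhdsGT_zero (neg_neg_of_pos hr)).const_mul_atTop hq₀).eventually_ge_atTop K

theorem hasDerivAt_integral_of_mem_Ioo {E : Type*} [NormedAddCommGroup E] [NormedSpace ℝ E]
    [CompleteSpace E] {φ : ℝ → E} {a b x : ℝ} (hφ : ContinuousOn φ (Ioo a b))
    (hφi : IntegrableOn φ (Ioo a b)) (hx : x ∈ Ioo a b) :
    HasDerivAt (fun x => ∫ t in a..x, φ t) (φ x) x := by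
  have hcont : ∀ y ∈ Ioo a b, ContinuousAt φ y := fun y hy =>
    hφ.continuousAt (Ioo_mem_nhds hy.1 hy.2)
  refine intervalIntegral.integral_hasDerivAt_right ?_
    (ContinuousAt.stronglyMeasurableAtFilter isOpen_Ioo hcont x hx) (hcont x hx)
  rw [intervalIntegrable_iff_integrableOn_Ioo_of_le hx.1.le]
  exact hφi.mono_set (Ioo_subset_Ioo_right hx.2.le)

theorem hasDerivAt_of_tendsto_of_norm_le {E ι : Type*} [NormedAddCommGroup E] [NormedSpace ℝ E]
    [CompleteSpace E] {l : Filter ι} [l.NeBot] [l.IsCountablyGenerated] {a b C : ℝ}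
    {w w' : ι → ℝ → E} {W D : ℝ → E}
    (hw : ∀ᶠ n in l, ∀ x ∈ Icc a b, HasDerivAt (w n) (w' n x) x)
    (hw'c : ∀ᶠ n in l, ContinuousOn (w' n) (Icc a b))
    (hw'b : ∀ᶠ n in l, ∀ x ∈ Icc a b, ‖w' n x‖ ≤ C) (hD : ContinuousOn D (Icc a b))
    (hW : ∀ x ∈ Icc a b, Tendsto (fun n => w n x) l (𝓝 (W x)))
    (hw'D : ∀ x ∈ Icc a b, Tendsto (fun n => w' n x) l (𝓝 (D x))) {x : ℝ} (hx : x ∈ Ioo a b) :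
    HasDerivAt W (D x) x := by
  have hintegral : ∀ y ∈ Icc a b, ∫ t in a..y, D t = W y - W a := by
    intro y hy
    have hsub : Icc a y ⊆ Icc a b := Icc_subset_Icc_right hy.2
    have hsub' : uIoc a y ⊆ Icc a b := by
      rw [uIoc_of_le hy.1]
      exact Ioc_subset_Icc_self.trans hsub
    refine tendsto_nhds_unique (intervalIntegral.tendsto_integral_filter_of_dominated_convergence
      (fun _ => C) (hw'c.mono fun n hn => (hn.mono hsub').aestronglyMeasurable measurableSet_uIoc)
      (hw'b.mono fun n hn => ae_of_all _ fun t ht => hn t (hsub' ht)) (by simp)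
      (ae_of_all _ fun t ht => hw'D t (hsub' ht)))
      (((hW y hy).sub (hW a (left_mem_Icc.2 (hx.1.trans hx.2).le))).congr' ?_)
    filter_upwards [hw, hw'c] with n hn hnc
    rw [← uIcc_of_le hy.1] at hsub
    exact (intervalIntegral.integral_eq_sub_of_hasDerivAt (fun t ht => hn t (hsub ht))
      (hnc.mono hsub).intervalIntegrable).symm
  have hderiv := (hasDerivAt_integral_of_mem_Ioo (hD.mono Ioo_subset_Icc_self)
    (hD.integrableOn_Icc.mono_set Ioo_subset_Icc_self) hx).const_add (W a)
  refine hderiv.congr_of_eventuallyEq ?_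
  filter_upwards [Icc_mem_nhds hx.1 hx.2] with y hy
  rw [hintegral y hy, add_sub_cancel]

theorem lipschitzOnWith_of_tendsto {α β ι : Type*} [PseudoMetricSpace α] [PseudoMetricSpace β]
    {l : Filter ι} [l.NeBot] {K : NNReal} {s : Set α} {w : ι → α → β} {W : α → β}
    (hw : ∀ᶠ n in l, LipschitzOnWith K (w n) s)
    (hW : ∀ x ∈ s, Tendsto (fun n => w n x) l (𝓝 (W x))) : LipschitzOnWith K W s :=
  LipschitzOnWith.of_dist_le_mul fun x hx y hy =>
    le_of_tendsto ((hW x hx).dist (hW y hy)) (hw.mono fun _ hn => hn.dist_le_mul x hx y hy)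

section CompactInterval

variable {a b c r : ℝ} {h q : ℝ → ℝ}

theorem exists_hasDerivAt_truncated {d η ε : ℝ} (hr : 0 ≤ r) (hε : 0 < ε) (hb : b ∈ Icc a d)
    (hh : ContinuousOn h (Icc a d)) (hq : ContinuousOn q (Icc a d)) :
    ∃ w : ℝ → ℝ, w b = η ∧
      ∀ x ∈ Ioo a d, HasDerivAt w (h x - q x * max (w x) ε ^ (-r)) x := by
  obtain ⟨M, hM⟩ := isCompact_Icc.exists_bound_of_continuousOn hh
  obtain ⟨Q, hQ⟩ := isCompact_Icc.exists_bound_of_continuousOn hq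
  have hQ₀ : 0 ≤ Q := (norm_nonneg _).trans (hQ b hb)
  have hM₀ : 0 ≤ M := (norm_nonneg _).trans (hM b hb)
  have htrunc : ∀ z : ℝ, 0 ≤ max z ε ^ (-r) ∧ max z ε ^ (-r) ≤ ε ^ (-r) := fun z =>
    ⟨Real.rpow_nonneg (hε.le.trans (le_max_right _ _)) _,
      Real.rpow_le_rpow_of_nonpos hε (le_max_right _ _) (neg_nonpos.2 hr)⟩
  refine exists_hasDerivAt_of_lipschitzWith (v := fun t z => h t - q t * max z ε ^ (-r))
    (K := Q.toNNReal * (r * ε ^ (-r - 1)).toNNReal) (L := (M + Q * ε ^ (-r)).toNNReal) hb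
    (fun t ht => LipschitzWith.of_dist_le_mul fun y z => ?_)
    (fun z => hh.sub (hq.mul continuousOn_const)) (fun t ht z => ?_) η
  · rw [dist_sub_left, Real.dist_eq, ← mul_sub, abs_mul, ← Real.norm_eq_abs (q t), NNReal.coe_mul,
      Real.coe_toNNReal _ hQ₀, mul_assoc]
    exact mul_le_mul (hQ t ht) ((lipschitzWith_max_rpow_neg hr hε).dist_le_mul y z)
      (abs_nonneg _) hQ₀
  · rw [Real.coe_toNNReal _ (add_nonneg hM₀ (mul_nonneg hQ₀ (Real.rpow_nonneg hε.le _)))]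
    refine (norm_sub_le _ _).trans (add_le_add (hM t ht) ?_)
    rw [norm_mul, Real.norm_of_nonneg (htrunc z).1]
    exact mul_le_mul (hQ t ht) (htrunc z).2 (htrunc z).1 hQ₀

/-- Below `ε` the singular term dominates, so `ε` is a lower barrier. -/
theorem exists_forall_add_le_mul_rpow_neg {η : ℝ} (hr : 0 < r) (hη : 0 < η) (K : ℝ)
    (hab : a ≤ b) (hh : ContinuousOn h (Icc a b)) (hqc : ContinuousOn q (Icc a b))
    (hq : ∀ x ∈ Icc a b, 0 < q x) :
    ∃ ε, 0 < ε ∧ ε ≤ η ∧ ∀ x ∈ Icc a b, h x + K ≤ q x * ε ^ (-r) := by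
  obtain ⟨x₀, hx₀, hmin⟩ := isCompact_Icc.exists_isMinOn (nonempty_Icc.2 hab) hqc
  obtain ⟨M, hM⟩ := isCompact_Icc.bddAbove_image hh
  obtain ⟨ε, ⟨hεK, hε⟩, hε₀ : 0 < ε⟩ := ((eventually_le_mul_rpow_neg hr (hq x₀ hx₀) (M + K)).and
    (eventually_nhdsWithin_of_eventually_nhds (eventually_le_nhds hη))).and
      self_mem_nhdsWithin |>.exists
  refine ⟨ε, hε₀, hε, fun x hx => ?_⟩
  calc h x + K ≤ M + K := add_le_add_left (hM (mem_image_of_mem h hx)) K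
    _ ≤ q x₀ * ε ^ (-r) := hεK
    _ ≤ q x * ε ^ (-r) :=
      mul_le_mul_of_nonneg_right (isMinOn_iff.1 hmin x hx) (Real.rpow_nonneg hε₀.le _)

theorem exists_isProfileOn_Ioc {d η : ℝ} (hr : 0 < r) (hη : 0 < η) (hab : a < b) (hbd : b < d)
    (hh : ContinuousOn h (Icc a d)) (hqc : ContinuousOn q (Icc a d))
    (hq : ∀ x ∈ Icc a d, 0 < q x) :
    ∃ w : ℝ → ℝ, w b = η ∧ IsProfileOn r h q w (Ioc a b) := by
  obtain ⟨ε, hε₀, hεη, hbarrier⟩ :=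
    exists_forall_add_le_mul_rpow_neg hr hη 0 (hab.trans hbd).le hh hqc hq
  obtain ⟨w, hwb, hw⟩ :=
    exists_hasDerivAt_truncated (η := η) hr.le hε₀ ⟨hab.le, hbd.le⟩ hh hqc
  have hsub : ∀ x ∈ Ioc a b, Icc x b ⊆ Ioo a d := fun x hx =>
    Icc_subset_Ioo hx.1 hbd
  have hεw : ∀ x ∈ Ioc a b, ε ≤ w x := by
    intro x hx
    have hderiv : ∀ y ∈ Icc x b, HasDerivAt (fun y => ε - w y) _ y := fun y hy =>
      (hw y (hsub x hx hy)).const_sub ε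
    refine sub_nonpos.1 (le_of_deriv_nonneg_of_pos (φ := fun y => ε - w y) le_rfl
      (fun y hy => (hderiv y hy).differentiableAt) (fun y hy hpos => ?_)
      (sub_nonpos.2 (hεη.trans hwb.ge)) (left_mem_Icc.2 hx.2))
    rw [(hderiv y hy).deriv, max_eq_right (sub_pos.1 hpos).le]
    linarith [hbarrier y (Ioo_subset_Icc_self (hsub x hx hy))]
  refine ⟨w, hwb, fun x hx => ⟨hε₀.trans_le (hεw x hx), ?_⟩⟩
  simpa [max_eq_left (hεw x hx)] using hw x (Ioc_subset_Ioo_right hbd hx)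

theorem exists_pos_forall_isProfileOn_le (hr : 0 < r) (hab : a ≤ b) (hbc : b < c)
    (hh : ContinuousOn h (Icc a c)) (hqc : ContinuousOn q (Icc a c))
    (hq : ∀ x ∈ Icc a c, 0 < q x) :
    ∃ m > 0, ∀ w : ℝ → ℝ, IsProfileOn r h q w (Icc a c) → ∀ x ∈ Icc a b, m ≤ w x := by
  have hac : a < c := hab.trans_lt hbc
  obtain ⟨ε, hε₀, -, hε⟩ :=
    exists_forall_add_le_mul_rpow_neg hr zero_lt_one 1 hac.le hh hqc hq
  -- A line vanishing at `c`, so flat that it stays below `ε` and its slope is at least `-1`.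
  obtain ⟨k, hk₀, hk₁, hkε⟩ : ∃ k : ℝ, 0 < k ∧ k ≤ 1 ∧ k * (c - a) ≤ ε :=
    ⟨min 1 (ε / (c - a)), lt_min one_pos (div_pos hε₀ (sub_pos.2 hac)), min_le_left _ _,
      (le_div_iff₀ (sub_pos.2 hac)).1 (min_le_right _ _)⟩
  refine ⟨k * (c - b), mul_pos hk₀ (sub_pos.2 hbc), fun w hw x hx => ?_⟩
  have hderiv : ∀ y ∈ Icc a c, HasDerivAt (fun y => k * (c - y) - w y)
      (k * -1 - (h y - q y * w y ^ (-r))) y := fun y hy =>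
    (((hasDerivAt_id y).const_sub c).const_mul k).sub (hw y hy).2
  have hline : k * (c - x) - w x ≤ 0 := by
    refine le_of_deriv_nonneg_of_pos (φ := fun y => k * (c - y) - w y) le_rfl
      (fun y hy => (hderiv y hy).differentiableAt) (fun y hy hpos => ?_)
      (by simpa using (hw c (right_mem_Icc.2 hac.le)).1.le) ⟨hx.1, hx.2.trans hbc.le⟩
    have hwε : w y ≤ ε := (sub_pos.1 hpos).le.trans
      ((mul_le_mul_of_nonneg_left (sub_le_sub_left hy.1 c) hk₀.le).trans hkε)
    have hanti : q y * ε ^ (-r) ≤ q y * w y ^ (-r) := mul_le_mul_of_nonneg_left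
      (Real.rpow_le_rpow_of_nonpos (hw y hy).1 hwε (neg_nonpos.2 hr.le)) (hq y hy).le
    rw [(hderiv y hy).deriv]
    linarith [hε y hy]
  exact (mul_le_mul_of_nonneg_left (sub_le_sub_left hx.2 c) hk₀.le).trans (sub_nonpos.1 hline)

theorem norm_sub_mul_rpow_neg_le {m M Q : ℝ} {x z : ℝ} (hr : 0 ≤ r) (hm : 0 < m)
    (hM : ‖h x‖ ≤ M) (hQ : ‖q x‖ ≤ Q) (hz : m ≤ z) :
    ‖h x - q x * z ^ (-r)‖ ≤ M + Q * m ^ (-r) := by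
  refine (norm_sub_le _ _).trans (add_le_add hM ?_)
  rw [norm_mul, Real.norm_of_nonneg (Real.rpow_nonneg (hm.le.trans hz) _)]
  exact mul_le_mul hQ (Real.rpow_le_rpow_of_nonpos hm hz (neg_nonpos.2 hr))
    (Real.rpow_nonneg (hm.le.trans hz) _) ((norm_nonneg _).trans hQ)

theorem IsProfileOn.of_tendsto_of_le {ι : Type*} {l : Filter ι} [l.NeBot]
    [l.IsCountablyGenerated] {m : ℝ} {w : ι → ℝ → ℝ} {W : ℝ → ℝ} (hr : 0 ≤ r) (hm : 0 < m)
    (hh : ContinuousOn h (Icc a b)) (hq : ContinuousOn q (Icc a b))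
    (hw : ∀ᶠ n in l, IsProfileOn r h q (w n) (Icc a b))
    (hwm : ∀ᶠ n in l, ∀ x ∈ Icc a b, m ≤ w n x)
    (hW : ∀ x ∈ Icc a b, Tendsto (fun n => w n x) l (𝓝 (W x))) :
    IsProfileOn r h q W (Ioo a b) := by
  obtain ⟨M, hM⟩ := isCompact_Icc.exists_bound_of_continuousOn hh
  obtain ⟨Q, hQ⟩ := isCompact_Icc.exists_bound_of_continuousOn hq
  have hWpos : ∀ x ∈ Icc a b, 0 < W x := fun x hx =>
    hm.trans_le (ge_of_tendsto (hW x hx) (hwm.mono fun n hn => hn x hx))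
  have hbound : ∀ᶠ n in l, ∀ x ∈ Icc a b,
      ‖h x - q x * w n x ^ (-r)‖ ≤ M + Q * m ^ (-r) := hwm.mono fun n hn x hx =>
    norm_sub_mul_rpow_neg_le hr hm (hM x hx) (hQ x hx) (hn x hx)
  have hcont : ∀ v : ℝ → ℝ, ContinuousOn v (Icc a b) → (∀ x ∈ Icc a b, 0 < v x) →
      ContinuousOn (fun x => h x - q x * v x ^ (-r)) (Icc a b) := fun v hv hv₀ =>
    hh.sub (hq.mul (hv.rpow_const fun x hx => Or.inl (hv₀ x hx).ne'))
  have hWc : ContinuousOn W (Icc a b) := by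
    refine (lipschitzOnWith_of_tendsto (K := (M + Q * m ^ (-r)).toNNReal) ?_ hW).continuousOn
    filter_upwards [hw, hbound] with n hn hnb
    refine (convex_Icc a b).lipschitzOnWith_of_nnnorm_hasDerivWithin_le
      (fun x hx => (hn x hx).2.hasDerivWithinAt) (fun x hx => ?_)
    exact NNReal.coe_le_coe.1 ((hnb x hx).trans (Real.le_coe_toNNReal _))
  refine fun x hx => ⟨hWpos x (Ioo_subset_Icc_self hx), ?_⟩
  exact hasDerivAt_of_tendsto_of_norm_le (hw.mono fun n hn x hx => (hn x hx).2)
    (hw.mono fun n hn => hcont _ hn.continuousOn fun x hx => (hn x hx).1) hbound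
    (hcont W hWc hWpos) hW (fun y hy => (((hW y hy).rpow_const
      (Or.inl (hWpos y hy).ne')).const_mul _).const_sub _) hx

theorem IsProfileOn.of_tendsto {ι : Type*} {l : Filter ι} [l.NeBot]
    [l.IsCountablyGenerated] {w : ι → ℝ → ℝ} {W : ℝ → ℝ} (hr : 0 < r)
    (hh : ContinuousOn h (Icc a b)) (hqc : ContinuousOn q (Icc a b))
    (hq : ∀ x ∈ Icc a b, 0 < q x) (hw : ∀ᶠ n in l, IsProfileOn r h q (w n) (Icc a b))
    (hW : ∀ x ∈ Icc a b, Tendsto (fun n => w n x) l (𝓝 (W x))) :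
    IsProfileOn r h q W (Ioo a b) := by
  intro x hx
  obtain ⟨c, hxc, hcb⟩ := exists_between hx.2
  obtain ⟨m, hm, hlow⟩ :=
    exists_pos_forall_isProfileOn_le hr (hx.1.trans hxc).le hcb hh hqc hq
  have hsub : Icc a c ⊆ Icc a b := Icc_subset_Icc_right hcb.le
  exact IsProfileOn.of_tendsto_of_le hr.le hm (hh.mono hsub) (hqc.mono hsub)
    (hw.mono fun n hn => hn.mono hsub) (hw.mono fun n hn => hlow (w n) hn)
    (fun y hy => hW y (hsub hy)) x ⟨hx.1, hxc⟩

end CompactInterval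

theorem exists_tendsto_of_antitoneOn_Ici {u : ℕ → ℝ} {N : ℕ} (hu : AntitoneOn u (Ici N))
    (hbdd : BddBelow (u '' Ici N)) : ∃ L, Tendsto u atTop (𝓝 L) := by
  have hanti : Antitone fun n => u (n + N) := fun n k hnk =>
    hu (mem_Ici.2 (Nat.le_add_left N n)) (mem_Ici.2 (Nat.le_add_left N k)) (by omega)
  have hrange : BddBelow (range fun n => u (n + N)) :=
    hbdd.mono (range_subset_iff.2 fun n => mem_image_of_mem u (mem_Ici.2 (Nat.le_add_left N n)))
  exact ⟨_, (tendsto_add_atTop_iff_nat N).1 (tendsto_atTop_ciInf hanti hrange)⟩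

theorem continuousOn_integral_of_integrableOn_Ioo {E : Type*} [NormedAddCommGroup E]
    [NormedSpace ℝ E] {φ : ℝ → E} {a b : ℝ} (hab : a ≤ b) (hφ : IntegrableOn φ (Ioo a b)) :
    ContinuousOn (fun x => ∫ t in a..x, φ t) (Icc a b) := by
  have hφ' : IntervalIntegrable φ volume a b :=
    (intervalIntegrable_iff_integrableOn_Ioo_of_le hab).2 hφ
  simpa only [uIcc_of_le hab] using
    intervalIntegral.continuousOn_primitive_interval' hφ' left_mem_uIcc

section OpenInterval

variable {a b r : ℝ} {h q v w : ℝ → ℝ}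

theorem IsProfileOn.exists_tendsto_of_antitone {J : ℕ → Set ℝ} {w : ℕ → ℝ → ℝ} (hr : 0 < r)
    (hh : ContinuousOn h (Ioo a b)) (hqc : ContinuousOn q (Ioo a b))
    (hq : ∀ x ∈ Ioo a b, 0 < q x)
    (hJ : ∀ c d, a < c → d < b → ∀ᶠ n in atTop, Icc c d ⊆ J n)
    (hw : ∀ n, IsProfileOn r h q (w n) (J n))
    (hanti : ∀ n k, n ≤ k → ∀ x ∈ J n, w k x ≤ w n x) :
    ∃ W, IsProfileOn r h q W (Ioo a b) ∧
      ∀ x ∈ Ioo a b, Tendsto (fun n => w n x) atTop (𝓝 (W x)) := by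
  have hlim : ∀ x ∈ Ioo a b, ∃ L, Tendsto (fun n => w n x) atTop (𝓝 L) := by
    intro x hx
    obtain ⟨N, hN⟩ := eventually_atTop.1 (hJ x x hx.1 hx.2)
    have hmem : ∀ n ∈ Ici N, x ∈ J n := fun n hn => hN n hn ⟨le_rfl, le_rfl⟩
    exact exists_tendsto_of_antitoneOn_Ici (N := N)
      (fun n hn k _ hnk => hanti n k hnk x (hmem n hn))
      ⟨0, forall_mem_image.2 fun n hn => (hw n x (hmem n hn)).1.le⟩
  choose! W hW using hlim
  refine ⟨W, fun x hx => ?_, hW⟩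
  obtain ⟨c, hac, hcx⟩ := exists_between hx.1
  obtain ⟨d, hxd, hdb⟩ := exists_between hx.2
  have hcd : Icc c d ⊆ Ioo a b := Icc_subset_Ioo hac hdb
  exact IsProfileOn.of_tendsto hr (hh.mono hcd) (hqc.mono hcd) (fun y hy => hq y (hcd hy))
    ((hJ c d hac hdb).mono fun n hn => (hw n).mono hn) (fun y hy => hW y (hcd hy)) x ⟨hcx, hxd⟩

/-- The profile is the decreasing limit of the solutions on compact intervals exhausting `(a, b)`
which agree with `v` at the right end. -/
theorem IsSubprofileOn.exists_isProfileOn_le (hr : 0 < r) (hab : a < b)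
    (hh : ContinuousOn h (Ioo a b)) (hqc : ContinuousOn q (Ioo a b))
    (hq : ∀ x ∈ Ioo a b, 0 < q x) (hv : IsSubprofileOn r h q v (Ioo a b)) :
    ∃ w, IsProfileOn r h q w (Ioo a b) ∧ ∀ x ∈ Ioo a b, w x ≤ v x := by
  obtain ⟨m, ham, hmb⟩ := exists_between hab
  obtain ⟨α, hα, hαm, hαa⟩ := exists_seq_strictAnti_tendsto' ham
  obtain ⟨β, hβ, hβm, hβb⟩ := exists_seq_strictMono_tendsto' hmb
  have hJ : ∀ n, Icc (α n) (β n) ⊆ Ioo a b := fun n => Icc_subset_Ioo (hαm n).1 (hβm n).2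
  have hαβ : ∀ n k, α n < β k := fun n k => (hαm n).2.trans (hβm k).1
  have hβJ : ∀ n, β n ∈ Icc (α n) (β n) := fun n => right_mem_Icc.2 (hαβ n n).le
  choose w hwβ hw' using fun n => exists_isProfileOn_Ioc (r := r) (h := h) (q := q) hr
    (hv _ (hJ n (hβJ n))).1 (hαβ (n + 1) n) (hβ n.lt_succ_self) (hh.mono (hJ _))
    (hqc.mono (hJ _)) (fun x hx => hq x (hJ _ hx))
  have hw : ∀ n, IsProfileOn r h q (w n) (Icc (α n) (β n)) := fun n =>
    (hw' n).mono fun x hx => ⟨(hα n.lt_succ_self).trans_le hx.1, hx.2⟩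
  have hcompare : ∀ n u v, IsProfileOn r h q u (Icc (α n) (β n)) →
      IsSubprofileOn r h q v (Icc (α n) (β n)) → u (β n) ≤ v (β n) →
      ∀ x ∈ Icc (α n) (β n), u x ≤ v x := fun n u v hu hv hb x hx => by
    simpa using hu.le_add_of_isSubprofileOn hr.le le_rfl (fun y hy => (hq y (hJ n hy)).le) hv
      (by simpa using hb) hx
  have hwv : ∀ n, ∀ x ∈ Icc (α n) (β n), w n x ≤ v x := fun n =>
    hcompare n _ _ (hw n) (hv.mono (hJ n)) (hwβ n).le
  have hanti : ∀ n k, n ≤ k → ∀ x ∈ Icc (α n) (β n), w k x ≤ w n x := fun n k hnk => by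
    have hsub : Icc (α n) (β n) ⊆ Icc (α k) (β k) :=
      Icc_subset_Icc (hα.antitone hnk) (hβ.monotone hnk)
    exact hcompare n _ _ ((hw k).mono hsub) (hw n).isSubprofileOn
      ((hwv k _ (hsub (hβJ n))).trans (hwβ n).ge)
  have hexhaust : ∀ c d, a < c → d < b → ∀ᶠ n in atTop, Icc c d ⊆ Icc (α n) (β n) :=
    fun c d hc hd => ((hαa.eventually (eventually_lt_nhds hc)).and
      (hβb.eventually (eventually_gt_nhds hd))).mono fun n hn =>
        Icc_subset_Icc hn.1.le hn.2.le
  obtain ⟨W, hW, hlim⟩ := IsProfileOn.exists_tendsto_of_antitone hr hh hqc hq hexhaust hw hanti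
  exact ⟨W, hW, fun x hx => le_of_tendsto (hlim x hx)
    ((hexhaust x x hx.1 hx.2).mono fun n hn => hwv n x (hn ⟨le_rfl, le_rfl⟩))⟩

theorem isSubprofileOn_const_mul_rpow {C M m s : ℝ} {Y : ℝ → ℝ} {I : Set ℝ} (hr : 0 < r)
    (hs : s = 1 / (r + 1)) (hC : 1 ≤ C) (hCs : 1 ≤ C * s) (hCM : M ≤ C * s * m ^ (s - 1))
    (hM : ∀ x ∈ I, |h x| ≤ M) (hq : ∀ x ∈ I, 0 ≤ q x)
    (hY : ∀ x ∈ I, 0 < Y x ∧ Y x ≤ m ∧ HasDerivAt Y (-(q x + 1)) x) :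
    IsSubprofileOn r h q (fun x => C * Y x ^ s) I := by
  intro x hx
  obtain ⟨hY₀, hYm, hY'⟩ := hY x hx
  have hC₀ : 0 < C := zero_lt_one.trans_le hC
  have hs₁ : s - 1 ≤ 0 := by
    rw [hs, sub_nonpos, div_le_one (by positivity)]
    linarith
  have hsing : (C * Y x ^ s) ^ (-r) = C ^ (-r) * Y x ^ (s - 1) := by
    rw [Real.mul_rpow hC₀.le (Real.rpow_nonneg hY₀.le _), ← Real.rpow_mul hY₀.le,
      show s * -r = s - 1 by rw [hs]; field_simp; ring]
  have hderiv : HasDerivAt (fun x => C * Y x ^ s) _ x :=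
    (hY'.rpow_const (Or.inl hY₀.ne')).const_mul C
  refine ⟨mul_pos hC₀ (Real.rpow_pos_of_pos hY₀ _), hderiv.differentiableAt, ?_⟩
  rw [hderiv.deriv, hsing]
  have hZ : 0 < Y x ^ (s - 1) := Real.rpow_pos_of_pos hY₀ _
  have hdominates : M ≤ C * s * Y x ^ (s - 1) := hCM.trans
    (mul_le_mul_of_nonneg_left (Real.rpow_le_rpow_of_nonpos hY₀ hYm hs₁)
      (zero_le_one.trans hCs))
  have hcoeff : C ^ (-r) * (q x * Y x ^ (s - 1)) ≤ C * s * (q x * Y x ^ (s - 1)) :=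
    mul_le_mul_of_nonneg_right
      ((Real.rpow_le_one_of_one_le_of_nonpos hC (neg_nonpos.2 hr.le)).trans hCs)
      (mul_nonneg (hq x hx) hZ.le)
  linarith [neg_le_of_abs_le (hM x hx)]

/-- The exponent `s = 1 / (r + 1)` balances `w'` against `w⁻ʳ` in `w' = -q w⁻ʳ`. -/
theorem exists_isSubprofileOn_tendsto_right (hr : 0 < r) (hab : a < b)
    (hh : ContinuousOn h (Icc a b)) (hqc : ContinuousOn q (Ioo a b))
    (hq : ∀ x ∈ Ioo a b, 0 ≤ q x) (hqi : IntegrableOn q (Ioo a b)) :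
    ∃ v, IsSubprofileOn r h q v (Ioo a b) ∧ Tendsto v (𝓝[<] b) (𝓝 0) := by
  obtain ⟨M, hM⟩ := isCompact_Icc.exists_bound_of_continuousOn hh
  set P : ℝ → ℝ := fun x => ∫ t in a..x, (q t + 1)
  have hi : IntegrableOn (fun t => q t + 1) (Ioo a b) := hqi.add (by simp)
  have hPc : ContinuousOn P (Icc a b) := continuousOn_integral_of_integrableOn_Ioo hab.le hi
  have hP' : ∀ x ∈ Ioo a b, HasDerivAt P (q x + 1) x := fun x hx =>
    hasDerivAt_integral_of_mem_Ioo (hqc.add continuousOn_const) hi hx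
  have hPmono : StrictMonoOn P (Icc a b) := by
    refine strictMonoOn_of_deriv_pos (convex_Icc a b) hPc fun x hx => ?_
    rw [interior_Icc] at hx
    rw [(hP' x hx).deriv]
    linarith [hq x hx]
  have ha : a ∈ Icc a b := left_mem_Icc.2 hab.le
  have hb : b ∈ Icc a b := right_mem_Icc.2 hab.le
  set m := P b - P a
  have hm : 0 < m := sub_pos.2 (hPmono ha hb hab)
  set s := 1 / (r + 1) with hs
  have hs₀ : 0 < s := by positivity
  have hms : 0 < s * m ^ (s - 1) := mul_pos hs₀ (Real.rpow_pos_of_pos hm _)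
  obtain ⟨C, hC, hCs, hCM⟩ : ∃ C : ℝ, 1 ≤ C ∧ 1 ≤ C * s ∧ M ≤ C * s * m ^ (s - 1) := by
    refine ((eventually_ge_atTop 1).and ((eventually_ge_atTop (1 / s)).and
      (eventually_ge_atTop (M / (s * m ^ (s - 1)))))).exists.imp fun C hC => ⟨hC.1, ?_, ?_⟩
    · exact (div_le_iff₀ hs₀).1 hC.2.1
    · rw [mul_assoc]
      exact (div_le_iff₀ hms).1 hC.2.2
  refine ⟨fun x => C * (P b - P x) ^ s, isSubprofileOn_const_mul_rpow hr hs hC hCs hCM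
    (fun x hx => hM x (Ioo_subset_Icc_self hx)) hq fun x hx => ?_, ?_⟩
  · have hx' := Ioo_subset_Icc_self hx
    exact ⟨sub_pos.2 (hPmono hx' hb hx.2), sub_le_sub_left (hPmono.monotoneOn ha hx' hx.1.le) _,
      (hP' x hx).const_sub _⟩
  · have hPb : Tendsto P (𝓝[<] b) (𝓝 (P b)) := by
      rw [← nhdsWithin_Ioo_eq_nhdsLT hab]
      exact (hPc b hb).mono Ioo_subset_Icc_self
    simpa [Real.zero_rpow hs₀.ne'] using
      ((hPb.const_sub (P b)).rpow_const (Or.inr hs₀.le)).const_mul C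

theorem exists_isProfileOn_tendsto_right (hr : 0 < r) (hab : a < b)
    (hh : ContinuousOn h (Icc a b)) (hqc : ContinuousOn q (Ioo a b))
    (hq : ∀ x ∈ Ioo a b, 0 < q x) (hqi : IntegrableOn q (Ioo a b)) :
    ∃ w, IsProfileOn r h q w (Ioo a b) ∧ Tendsto w (𝓝[<] b) (𝓝 0) := by
  obtain ⟨v, hv, hvb⟩ :=
    exists_isSubprofileOn_tendsto_right hr hab hh hqc (fun x hx => (hq x hx).le) hqi
  obtain ⟨w, hw, hwv⟩ := hv.exists_isProfileOn_le hr hab (hh.mono Ioo_subset_Icc_self) hqc hq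
  refine ⟨w, hw, tendsto_of_tendsto_of_tendsto_of_le_of_le' tendsto_const_nhds hvb ?_ ?_⟩
  all_goals filter_upwards [Ioo_mem_nhdsLT hab] with x hx
  exacts [(hw x hx).1.le, hwv x hx]

theorem IsProfileOn.le_of_isSubprofileOn (hr : 0 ≤ r) (hq : ∀ x ∈ Ioo a b, 0 ≤ q x)
    (hw : IsProfileOn r h q w (Ioo a b)) (hwb : Tendsto w (𝓝[<] b) (𝓝 0))
    (hv : IsSubprofileOn r h q v (Ioo a b)) {x : ℝ} (hx : x ∈ Ioo a b) : w x ≤ v x := by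
  refine le_of_forall_pos_le_add fun η hη => ?_
  obtain ⟨c, hcη, hc⟩ := ((hwb.eventually (eventually_lt_nhds hη)).and
    (Ioo_mem_nhdsLT hx.2)).exists
  have hsub : Icc x c ⊆ Ioo a b := Icc_subset_Ioo hx.1 hc.2
  have hvc : 0 < v c := (hv c (hsub (right_mem_Icc.2 hc.1.le))).1
  exact (hw.mono hsub).le_add_of_isSubprofileOn hr hη.le (fun y hy => hq y (hsub hy))
    (hv.mono hsub) (by linarith) (left_mem_Icc.2 hc.1.le)

end OpenInterval

section LeftEndpoint

variable {a b : ℝ}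

theorem tendsto_integral_nhdsGT {E : Type*} [NormedAddCommGroup E] [NormedSpace ℝ E]
    {φ : ℝ → E} (hab : a < b) (hφ : IntegrableOn φ (Ioo a b)) :
    Tendsto (fun x => ∫ t in a..x, φ t) (𝓝[>] a) (𝓝 0) := by
  have hcont := (continuousOn_integral_of_integrableOn_Ioo hab.le hφ a
    (left_mem_Icc.2 hab.le)).mono Ioo_subset_Icc_self
  simpa [ContinuousWithinAt, nhdsWithin_Ioo_eq_nhdsGT hab] using hcont

theorem le_of_hasDerivAt_nonneg_of_tendsto {l x : ℝ} {φ φ' : ℝ → ℝ}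
    (hφ : ∀ x ∈ Ioo a b, HasDerivAt φ (φ' x) x) (hφ' : ∀ x ∈ Ioo a b, 0 ≤ φ' x)
    (hl : Tendsto φ (𝓝[>] a) (𝓝 l)) (hx : x ∈ Ioo a b) : l ≤ φ x := by
  have hmono : MonotoneOn φ (Ioo a b) :=
    monotoneOn_of_hasDerivWithinAt_nonneg (convex_Ioo a b)
      (fun y hy => (hφ y hy).continuousAt.continuousWithinAt)
      (fun y hy => (hφ y (interior_subset hy)).hasDerivWithinAt)
      (fun y hy => hφ' y (interior_subset hy))
  exact le_of_tendsto hl (Filter.mem_of_superset (Ioo_mem_nhdsGT hx.1)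
    fun y hy => hmono ⟨hy.1, hy.2.trans hx.2⟩ hx hy.2.le)

theorem lt_of_hasDerivAt_pos_of_tendsto {l x : ℝ} {φ φ' : ℝ → ℝ}
    (hφ : ∀ x ∈ Ioo a b, HasDerivAt φ (φ' x) x) (hφ' : ∀ x ∈ Ioo a b, 0 < φ' x)
    (hl : Tendsto φ (𝓝[>] a) (𝓝 l)) (hx : x ∈ Ioo a b) : l < φ x := by
  have hmono : StrictMonoOn φ (Ioo a b) :=
    strictMonoOn_of_hasDerivWithinAt_pos (convex_Ioo a b)
      (fun y hy => (hφ y hy).continuousAt.continuousWithinAt)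
      (fun y hy => (hφ y (interior_subset hy)).hasDerivWithinAt)
      (fun y hy => hφ' y (interior_subset hy))
  obtain ⟨y, hay, hyx⟩ := exists_between hx.1
  have hy : y ∈ Ioo a b := ⟨hay, hyx.trans hx.2⟩
  exact (le_of_hasDerivAt_nonneg_of_tendsto hφ (fun z hz => (hφ' z hz).le) hl hy).trans_lt
    (hmono hy hx hyx)

theorem IsProfileOn.lt_integral {r x : ℝ} {h q w : ℝ → ℝ} (hh : ContinuousOn h (Ioo a b))
    (hhi : IntegrableOn h (Ioo a b)) (hq : ∀ x ∈ Ioo a b, 0 < q x)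
    (hw : IsProfileOn r h q w (Ioo a b)) (hwa : Tendsto w (𝓝[>] a) (𝓝 0)) (hx : x ∈ Ioo a b) :
    w x < ∫ t in a..x, h t := by
  have hlim := (tendsto_integral_nhdsGT (hx.1.trans hx.2) hhi).sub hwa
  rw [sub_zero] at hlim
  refine sub_pos.1 (lt_of_hasDerivAt_pos_of_tendsto (φ := fun y => (∫ t in a..y, h t) - w y)
    (fun y hy => (hasDerivAt_integral_of_mem_Ioo hh hhi hy).fun_sub (hw y hy).2)
    (fun y hy => ?_) hlim hx)
  rw [sub_sub_cancel]
  exact mul_pos (hq y hy) (Real.rpow_pos_of_pos (hw y hy).1 _)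

end LeftEndpoint

theorem IsProfileOn.isSubprofileOn_add {r : ℝ} {h h' q w E E' : ℝ → ℝ} {I : Set ℝ} (hr : 0 ≤ r)
    (hq : ∀ x ∈ I, 0 ≤ q x) (hw : IsProfileOn r h q w I) (hE₀ : ∀ x ∈ I, 0 ≤ E x)
    (hE : ∀ x ∈ I, HasDerivAt E (E' x) x) (hE' : ∀ x ∈ I, E' x ≤ h' x - h x) :
    IsSubprofileOn r h' q (fun x => w x + E x) I := by
  intro x hx
  have hwx := (hw x hx).1
  have hle : w x ≤ w x + E x := le_add_of_nonneg_right (hE₀ x hx)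
  have hderiv := (hw x hx).2.fun_add (hE x hx)
  have hanti : q x * (w x + E x) ^ (-r) ≤ q x * w x ^ (-r) := mul_le_mul_of_nonneg_left
    (Real.rpow_le_rpow_of_nonpos hwx hle (neg_nonpos.2 hr)) (hq x hx)
  refine ⟨hwx.trans_le hle, hderiv.differentiableAt, ?_⟩
  rw [hderiv.deriv]
  linarith [hE' x hx]

/-- A profile on `(0, 1)` vanishing at both ends: the phase-plane trajectory of a travelling wave
joining `1` to `0`. -/
structure IsConnectingProfile (r : ℝ) (h q w : ℝ → ℝ) : Prop where
  isProfileOn : IsProfileOn r h q w (Ioo 0 1)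
  tendsto_zero : Tendsto w (𝓝[>] 0) (𝓝 0)
  tendsto_one : Tendsto w (𝓝[<] 1) (𝓝 0)

theorem IsProfileOn.isConnectingProfile {r : ℝ} {h q w v : ℝ → ℝ} (hr : 0 ≤ r)
    (hq : ∀ x ∈ Ioo (0 : ℝ) 1, 0 ≤ q x) (hw : IsProfileOn r h q w (Ioo 0 1))
    (hw₁ : Tendsto w (𝓝[<] 1) (𝓝 0)) (hv : IsSubprofileOn r h q v (Ioo 0 1))
    (hv₀ : Tendsto v (𝓝[>] 0) (𝓝 0)) : IsConnectingProfile r h q w where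
  isProfileOn := hw
  tendsto_zero := by
    refine tendsto_of_tendsto_of_tendsto_of_le_of_le' tendsto_const_nhds hv₀ ?_ ?_
    all_goals filter_upwards [Ioo_mem_nhdsGT zero_lt_one] with x hx
    exacts [(hw x hx).1.le, hw.le_of_isSubprofileOn hr hq hw₁ hv hx]
  tendsto_one := hw₁

theorem exists_isConnectingProfile {r : ℝ} {h q v : ℝ → ℝ} (hr : 0 < r)
    (hh : ContinuousOn h (Icc 0 1)) (hqc : ContinuousOn q (Ioo 0 1))
    (hq : ∀ x ∈ Ioo (0 : ℝ) 1, 0 < q x) (hqi : IntegrableOn q (Ioo 0 1))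
    (hv : IsSubprofileOn r h q v (Ioo 0 1)) (hv₀ : Tendsto v (𝓝[>] 0) (𝓝 0)) :
    ∃ w, IsConnectingProfile r h q w := by
  obtain ⟨w, hw, hw₁⟩ := exists_isProfileOn_tendsto_right hr zero_lt_one hh hqc hq hqi
  exact ⟨w, hw.isConnectingProfile hr.le (fun x hx => (hq x hx).le) hw₁ hv hv₀⟩

/-- The parameters `c` for which `w' = c g - f - q w⁻ʳ` has a connecting profile; they are the
admissible wave speeds. -/
def connectingSpeeds (r : ℝ) (f g q : ℝ → ℝ) : Set ℝ :=
  {c | ∃ w, IsConnectingProfile r (fun x => c * g x - f x) q w}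

section ConnectingSpeeds

variable {r : ℝ} {f g q : ℝ → ℝ}

theorem isUpperSet_connectingSpeeds (hr : 0 < r) (hf : ContinuousOn f (Icc 0 1))
    (hg : ContinuousOn g (Icc 0 1)) (hqc : ContinuousOn q (Ioo 0 1))
    (hq : ∀ x ∈ Ioo (0 : ℝ) 1, 0 < q x) (hqi : IntegrableOn q (Ioo 0 1))
    (hG : ∀ x ∈ Ioo (0 : ℝ) 1, 0 ≤ ∫ t in (0 : ℝ)..x, g t) :
    IsUpperSet (connectingSpeeds r f g q) := by
  rintro c c' hcc' ⟨w, hw⟩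
  have hgi : IntegrableOn g (Ioo 0 1) := hg.integrableOn_Icc.mono_set Ioo_subset_Icc_self
  have hsub : IsSubprofileOn r (fun x => c' * g x - f x) q
      (fun x => w x + (c' - c) * ∫ t in (0 : ℝ)..x, g t) (Ioo 0 1) :=
    hw.isProfileOn.isSubprofileOn_add hr.le (fun x hx => (hq x hx).le)
      (fun x hx => mul_nonneg (sub_nonneg.2 hcc') (hG x hx))
      (fun x hx => (hasDerivAt_integral_of_mem_Ioo (hg.mono Ioo_subset_Icc_self) hgi
        hx).const_mul _) (fun x _ => by linarith)
  have hlim := hw.tendsto_zero.add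
    ((tendsto_integral_nhdsGT zero_lt_one hgi).const_mul (c' - c))
  rw [mul_zero, add_zero] at hlim
  exact exists_isConnectingProfile hr ((hg.const_mul c').sub hf) hqc hq hqi hsub hlim

theorem IsProfileOn.tendsto_zero_of_mem_closure {c : ℝ} {w : ℝ → ℝ} (hr : 0 ≤ r)
    (hg : ContinuousOn g (Icc 0 1)) (hq : ∀ x ∈ Ioo (0 : ℝ) 1, 0 ≤ q x)
    (hw : IsProfileOn r (fun x => c * g x - f x) q w (Ioo 0 1)) (hw₁ : Tendsto w (𝓝[<] 1) (𝓝 0))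
    (hc : c ∈ closure (connectingSpeeds r f g q)) : Tendsto w (𝓝[>] 0) (𝓝 0) := by
  obtain ⟨M, hM⟩ := isCompact_Icc.exists_bound_of_continuousOn hg
  have hM₀ : 0 ≤ M := (norm_nonneg _).trans (hM 0 (left_mem_Icc.2 zero_le_one))
  refine tendsto_order.2 ⟨fun η hη => ?_, fun η hη => ?_⟩
  · filter_upwards [Ioo_mem_nhdsGT zero_lt_one] with x hx using hη.trans (hw x hx).1
  obtain ⟨c', ⟨w', hw'⟩, hcc'⟩ := Metric.mem_closure_iff.1 hc (η / (2 * (M + 1))) (by positivity)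
  have hsmall : |c - c'| * M ≤ η / 2 := by
    rw [Real.dist_eq, lt_div_iff₀ (by positivity)] at hcc'
    nlinarith [abs_nonneg (c - c')]
  have hsub : IsSubprofileOn r (fun x => c * g x - f x) q
      (fun x => w' x + |c - c'| * M * (1 - x)) (Ioo 0 1) := by
    refine hw'.isProfileOn.isSubprofileOn_add hr hq
      (fun x hx => mul_nonneg (by positivity) (sub_nonneg.2 hx.2.le))
      (fun x _ => ((hasDerivAt_id' x).const_sub 1).const_mul _) (fun x hx => ?_)
    have hbound : |(c - c') * g x| ≤ |c - c'| * M := by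
      rw [abs_mul]
      exact mul_le_mul_of_nonneg_left (hM x (Ioo_subset_Icc_self hx)) (abs_nonneg _)
    linarith [neg_le_of_abs_le hbound]
  filter_upwards [Ioo_mem_nhdsGT zero_lt_one,
    hw'.tendsto_zero.eventually_lt_const (half_pos hη)] with x hx hw'x
  have hle := hw.le_of_isSubprofileOn hr hq hw₁ hsub hx
  nlinarith [hx.1, hx.2, mul_nonneg (mul_nonneg (abs_nonneg (c - c')) hM₀) hx.1.le]

theorem isClosed_connectingSpeeds (hr : 0 < r) (hf : ContinuousOn f (Icc 0 1))
    (hg : ContinuousOn g (Icc 0 1)) (hqc : ContinuousOn q (Ioo 0 1))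
    (hq : ∀ x ∈ Ioo (0 : ℝ) 1, 0 < q x) (hqi : IntegrableOn q (Ioo 0 1)) :
    IsClosed (connectingSpeeds r f g q) := by
  refine isClosed_of_closure_subset fun c hc => ?_
  obtain ⟨w, hw, hw₁⟩ := exists_isProfileOn_tendsto_right (h := fun x => c * g x - f x) hr
    zero_lt_one ((hg.const_mul c).sub hf) hqc hq hqi
  exact ⟨w, hw, hw.tendsto_zero_of_mem_closure hr.le hg (fun x hx => (hq x hx).le) hw₁ hc, hw₁⟩

theorem bddBelow_connectingSpeeds (hf : ContinuousOn f (Icc 0 1))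
    (hg : ContinuousOn g (Icc 0 1)) (hq : ∀ x ∈ Ioo (0 : ℝ) 1, 0 < q x)
    (hG : ∃ x ∈ Ioo (0 : ℝ) 1, 0 < ∫ t in (0 : ℝ)..x, g t) :
    BddBelow (connectingSpeeds r f g q) := by
  obtain ⟨x, hx, hGx⟩ := hG
  refine ⟨(∫ t in (0 : ℝ)..x, f t) / ∫ t in (0 : ℝ)..x, g t, ?_⟩
  rintro c ⟨w, hw⟩
  have hh : ContinuousOn (fun t => c * g t - f t) (Icc 0 1) := (hg.const_mul c).sub hf
  have hint : ∀ {φ : ℝ → ℝ}, ContinuousOn φ (Icc 0 1) → IntervalIntegrable φ volume 0 x :=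
    fun hφ => (hφ.mono (Icc_subset_Icc_right hx.2.le)).intervalIntegrable_of_Icc hx.1.le
  have hpos := (hw.isProfileOn x hx).1.trans (hw.isProfileOn.lt_integral
    (hh.mono Ioo_subset_Icc_self) (hh.integrableOn_Icc.mono_set Ioo_subset_Icc_self) hq
    hw.tendsto_zero hx)
  rw [intervalIntegral.integral_sub ((hint hg).const_mul c) (hint hf),
    intervalIntegral.integral_const_mul, sub_pos] at hpos
  exact (div_le_iff₀ hGx).2 hpos.le

theorem exists_forall_integral_le_mul_integral {φ : ℝ → ℝ} {K : ℝ}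
    (hφ : IntegrableOn φ (Ioo 0 1)) (hφK : ∀ᶠ x in 𝓝[>] 0, φ x ≤ K)
    (hg : ContinuousOn g (Icc 0 1)) (hg₀ : 0 < g 0)
    (hG : ∀ x ∈ Ioc (0 : ℝ) 1, 0 < ∫ t in (0 : ℝ)..x, g t) :
    ∃ c, ∀ x ∈ Ioo (0 : ℝ) 1, ∫ t in (0 : ℝ)..x, φ t ≤ c * ∫ t in (0 : ℝ)..x, g t := by
  have hgi : IntegrableOn g (Ioo 0 1) := hg.integrableOn_Icc.mono_set Ioo_subset_Icc_self
  have hg' : ∀ᶠ x in 𝓝[>] 0, g 0 / 2 < g x :=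
    ((hg 0 (left_mem_Icc.2 zero_le_one)).mono_of_mem_nhdsWithin
      (Icc_mem_nhdsGT zero_lt_one)).eventually_const_lt (half_lt_self hg₀)
  obtain ⟨δ, ⟨hδ₀, -⟩, hδ⟩ :=
    (mem_nhdsGT_iff_exists_mem_Ioc_Ioo_subset zero_lt_one).1 (hφK.and hg')
  have hsub : Icc δ 1 ⊆ Icc 0 1 := Icc_subset_Icc_left hδ₀.le
  obtain ⟨C, hC⟩ := isCompact_Icc.exists_bound_of_continuousOn
    (((continuousOn_integral_of_integrableOn_Ioo zero_le_one hφ).mono hsub).div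
      ((continuousOn_integral_of_integrableOn_Ioo zero_le_one hgi).mono hsub)
      fun x hx => (hG x ⟨hδ₀.trans_le hx.1, hx.2⟩).ne')
  refine ⟨max (|K| / (g 0 / 2)) C, fun x hx => ?_⟩
  have hc₀ : 0 ≤ max (|K| / (g 0 / 2)) C := le_max_of_le_left (by positivity)
  rcases lt_or_ge x δ with hxδ | hδx
  · have hint : ∀ {ψ : ℝ → ℝ}, IntegrableOn ψ (Ioo 0 1) → IntervalIntegrable ψ volume 0 x :=
      fun hψ => (intervalIntegrable_iff_integrableOn_Ioo_of_le hx.1.le).2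
        (hψ.mono_set (Ioo_subset_Ioo_right hx.2.le))
    rw [← intervalIntegral.integral_const_mul]
    refine intervalIntegral.integral_mono_on_of_le_Ioo hx.1.le (hint hφ)
      ((hint hgi).const_mul _) fun t ht => ?_
    obtain ⟨hφt, hgt⟩ := hδ ⟨ht.1, ht.2.trans hxδ⟩
    calc φ t ≤ |K| := hφt.trans (le_abs_self K)
      _ = |K| / (g 0 / 2) * (g 0 / 2) := (div_mul_cancel₀ _ (half_pos hg₀).ne').symm
      _ ≤ _ := mul_le_mul (le_max_left _ _) hgt.le (half_pos hg₀).le hc₀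
  · exact (div_le_iff₀ (hG x ⟨hx.1, hx.2.le⟩)).1
      ((le_of_abs_le (hC x ⟨hδx, hx.2.le⟩)).trans (le_max_right _ _))

theorem exists_forall_mul_rpow_neg_le_add (hr : 0 ≤ r) (hq : ∀ x ∈ Ioo (0 : ℝ) 1, 0 ≤ q x)
    (hq₀ : q =O[𝓝[>] 0] fun x => x ^ r) :
    ∃ C D : ℝ, ∀ x ∈ Ioo (0 : ℝ) 1, q x * x ^ (-r) ≤ C + D * q x := by
  obtain ⟨C, hC, hCq⟩ := hq₀.exists_pos
  obtain ⟨δ, ⟨hδ₀, -⟩, hδ⟩ :=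
    (mem_nhdsGT_iff_exists_mem_Ioc_Ioo_subset zero_lt_one).1 hCq.bound
  refine ⟨C, δ ^ (-r), fun x hx => ?_⟩
  have hδr : 0 < δ ^ (-r) := Real.rpow_pos_of_pos hδ₀ _
  rcases lt_or_ge x δ with hxδ | hδx
  · have hbound : ‖q x‖ ≤ C * ‖x ^ r‖ := hδ ⟨hx.1, hxδ⟩
    rw [Real.norm_of_nonneg (hq x hx), Real.norm_of_nonneg (Real.rpow_nonneg hx.1.le r)] at hbound
    refine le_add_of_le_of_nonneg ?_ (mul_nonneg hδr.le (hq x hx))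
    rwa [Real.rpow_neg hx.1.le, ← div_eq_mul_inv, div_le_iff₀ (Real.rpow_pos_of_pos hx.1 r)]
  · rw [mul_comm]
    exact le_add_of_nonneg_of_le hC.le (mul_le_mul_of_nonneg_right
      (Real.rpow_le_rpow_of_nonpos hδ₀ hδx (neg_nonpos.2 hr)) (hq x hx))

theorem exists_isSubprofileOn_of_mul_rpow_neg_le {P : ℝ → ℝ} {K : ℝ} (hr : 0 ≤ r)
    (hf : ContinuousOn f (Icc 0 1)) (hg : ContinuousOn g (Icc 0 1)) (hg₀ : 0 < g 0)
    (hG : ∀ x ∈ Ioc (0 : ℝ) 1, 0 < ∫ t in (0 : ℝ)..x, g t) (hq : ∀ x ∈ Ioo (0 : ℝ) 1, 0 ≤ q x)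
    (hPc : ContinuousOn P (Ioo 0 1)) (hPi : IntegrableOn P (Ioo 0 1))
    (hPK : ∀ᶠ x in 𝓝[>] 0, P x ≤ K) (hqP : ∀ x ∈ Ioo (0 : ℝ) 1, q x * x ^ (-r) ≤ P x) :
    ∃ c v, IsSubprofileOn r (fun x => c * g x - f x) q v (Ioo 0 1) ∧
      Tendsto v (𝓝[>] 0) (𝓝 0) := by
  have hgi : IntegrableOn g (Ioo 0 1) := hg.integrableOn_Icc.mono_set Ioo_subset_Icc_self
  have hf₁ : ContinuousOn (fun x => f x + 1) (Icc 0 1) := hf.add continuousOn_const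
  have hφc : ContinuousOn (fun x => f x + 1 + P x) (Ioo 0 1) :=
    (hf₁.mono Ioo_subset_Icc_self).add hPc
  have hφi : IntegrableOn (fun x => f x + 1 + P x) (Ioo 0 1) :=
    (hf₁.integrableOn_Icc.mono_set Ioo_subset_Icc_self).add hPi
  obtain ⟨M, hM⟩ := isCompact_Icc.exists_bound_of_continuousOn hf₁
  have hφK : ∀ᶠ x in 𝓝[>] 0, f x + 1 + P x ≤ M + K := by
    filter_upwards [hPK, Ioo_mem_nhdsGT zero_lt_one] with x hPx hx
      using add_le_add (le_of_abs_le (hM x (Ioo_subset_Icc_self hx))) hPx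
  obtain ⟨c, hc⟩ := exists_forall_integral_le_mul_integral hφi hφK hg hg₀ hG
  set v : ℝ → ℝ :=
    fun x => x + (c * (∫ t in (0 : ℝ)..x, g t) - ∫ t in (0 : ℝ)..x, (f t + 1 + P t))
  have hv : ∀ x ∈ Ioo (0 : ℝ) 1, x ≤ v x := fun x hx =>
    le_add_of_nonneg_right (sub_nonneg.2 (hc x hx))
  have hv' : ∀ x ∈ Ioo (0 : ℝ) 1, HasDerivAt v (1 + (c * g x - (f x + 1 + P x))) x :=
    fun x hx => (hasDerivAt_id' x).fun_add (((hasDerivAt_integral_of_mem_Ioo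
      (hg.mono Ioo_subset_Icc_self) hgi hx).const_mul c).fun_sub
        (hasDerivAt_integral_of_mem_Ioo hφc hφi hx))
  refine ⟨c, v, fun x hx => ⟨hx.1.trans_le (hv x hx), (hv' x hx).differentiableAt, ?_⟩, ?_⟩
  · have hle : q x * v x ^ (-r) ≤ P x := (mul_le_mul_of_nonneg_left
      (Real.rpow_le_rpow_of_nonpos hx.1 (hv x hx) (neg_nonpos.2 hr)) (hq x hx)).trans (hqP x hx)
    rw [(hv' x hx).deriv]
    linarith
  · have hid : Tendsto (fun x : ℝ => x) (𝓝[>] 0) (𝓝 0) :=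
      tendsto_nhdsWithin_of_tendsto_nhds tendsto_id
    simpa using hid.add (((tendsto_integral_nhdsGT zero_lt_one hgi).const_mul c).sub
      (tendsto_integral_nhdsGT zero_lt_one hφi))

theorem connectingSpeeds_nonempty (hr : 0 < r) (hf : ContinuousOn f (Icc 0 1))
    (hg : ContinuousOn g (Icc 0 1)) (hg₀ : 0 < g 0)
    (hG : ∀ x ∈ Ioc (0 : ℝ) 1, 0 < ∫ t in (0 : ℝ)..x, g t) (hqc : ContinuousOn q (Ioo 0 1))
    (hq : ∀ x ∈ Ioo (0 : ℝ) 1, 0 < q x) (hqi : IntegrableOn q (Ioo 0 1))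
    (hq₀ : q =O[𝓝[>] 0] fun x => x ^ r) : (connectingSpeeds r f g q).Nonempty := by
  obtain ⟨C, D, hCD⟩ := exists_forall_mul_rpow_neg_le_add hr.le (fun x hx => (hq x hx).le) hq₀
  have hrpow : (fun x : ℝ => x ^ r) =O[𝓝[>] 0] fun _ => (1 : ℝ) :=
    (tendsto_nhdsWithin_of_tendsto_nhds
      (Real.continuousAt_rpow_const 0 r (Or.inr hr.le)).tendsto).isBigO_one ℝ
  obtain ⟨K, hK⟩ := ((Asymptotics.isBigO_const_const C one_ne_zero _).add
    ((hq₀.trans hrpow).const_mul_left D)).bound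
  have hPK : ∀ᶠ x in 𝓝[>] 0, C + D * q x ≤ K := by
    filter_upwards [hK] with x hx using by simpa using le_of_abs_le hx
  obtain ⟨c, v, hv, hv₀⟩ := exists_isSubprofileOn_of_mul_rpow_neg_le hr.le hf hg hg₀ hG
    (fun x hx => (hq x hx).le) (continuousOn_const.add (hqc.const_mul D))
    (continuousOn_const.integrableOn_Icc.mono_set Ioo_subset_Icc_self |>.add (hqi.const_mul D))
    hPK hCD
  exact ⟨c, exists_isConnectingProfile hr ((hg.const_mul c).sub hf) hqc hq hqi hv hv₀⟩

end ConnectingSpeeds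

theorem eq_Ici_csInf {S : Set ℝ} (hupper : IsUpperSet S) (hclosed : IsClosed S)
    (hne : S.Nonempty) (hbdd : BddBelow S) : S = Ici (sInf S) :=
  Subset.antisymm (fun _ hc => csInf_le hbdd hc)
    fun _ hc => hupper hc (hclosed.csInf_mem hne hbdd)

theorem connectingSpeeds_eq_Ici {r : ℝ} {f g q : ℝ → ℝ} (hr : 0 < r)
    (hf : ContinuousOn f (Icc 0 1)) (hg : ContinuousOn g (Icc 0 1)) (hg₀ : 0 < g 0)
    (hG : ∀ x ∈ Ioc (0 : ℝ) 1, 0 < ∫ t in (0 : ℝ)..x, g t) (hqc : ContinuousOn q (Ioo 0 1))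
    (hq : ∀ x ∈ Ioo (0 : ℝ) 1, 0 < q x) (hqi : IntegrableOn q (Ioo 0 1))
    (hq₀ : q =O[𝓝[>] 0] fun x => x ^ r) :
    connectingSpeeds r f g q = Ici (sInf (connectingSpeeds r f g q)) :=
  eq_Ici_csInf
    (isUpperSet_connectingSpeeds hr hf hg hqc hq hqi fun x hx => (hG x (Ioo_subset_Ioc_self hx)).le)
    (isClosed_connectingSpeeds hr hf hg hqc hq hqi)
    (connectingSpeeds_nonempty hr hf hg hg₀ hG hqc hq hqi hq₀)
    (bddBelow_connectingSpeeds hf hg hq ⟨1 / 2, by norm_num, hG _ (by norm_num)⟩)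

section Criteria

/-- The threshold `(1 + r)^(1 + r) / r^r` between `q` and `h Hʳ`, where `H' = h`. With
`r = 1 / (p - 1)` its `(p - 1)`-st power is `p^p / (p - 1)^(p - 1)`. -/
noncomputable def criticalConstant (r : ℝ) : ℝ :=
  (1 + r) ^ (1 + r) / r ^ r

variable {a b r : ℝ} {h q w : ℝ → ℝ}

theorem criticalConstant_mul_le_one {t : ℝ} (hr : 0 < r) (ht₀ : 0 ≤ t) (ht₁ : t ≤ 1) :
    criticalConstant r * ((1 - t) * t ^ r) ≤ 1 := by
  have : 0 ≤ 1 - t := sub_nonneg.2 ht₁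
  have hamgm := Real.geom_mean_le_arith_mean2_weighted (w₁ := 1 / (1 + r)) (w₂ := r / (1 + r))
    (p₁ := (1 - t) * (1 + r)) (p₂ := t * (1 + r) / r) (by positivity) (by positivity)
    (by positivity) (by positivity) (by field_simp)
  have hmean : 1 / (1 + r) * ((1 - t) * (1 + r)) + r / (1 + r) * (t * (1 + r) / r) = 1 := by
    field_simp
    ring
  rw [hmean] at hamgm
  have hpow := Real.rpow_le_one (by positivity) hamgm (add_pos one_pos hr).le
  rw [Real.mul_rpow (by positivity) (by positivity), ← Real.rpow_mul (by positivity),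
    ← Real.rpow_mul (by positivity), div_mul_cancel₀ _ (by positivity),
    div_mul_cancel₀ _ (by positivity), Real.rpow_one, Real.div_rpow (by positivity) hr.le,
    Real.mul_rpow ht₀ (by positivity)] at hpow
  calc criticalConstant r * ((1 - t) * t ^ r)
      = (1 - t) * (1 + r) * (t ^ r * (1 + r) ^ r / r ^ r) := by
        rw [criticalConstant, Real.rpow_add (by positivity), Real.rpow_one]
        ring
    _ ≤ 1 := hpow

theorem isSubprofileOn_mul_integral (hr : 0 < r) (hh : ContinuousOn h (Ioo a b))
    (hhi : IntegrableOn h (Ioo a b)) (hH : ∀ x ∈ Ioo a b, 0 < ∫ t in a..x, h t)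
    (hle : ∀ x ∈ Ioo a b, criticalConstant r * q x ≤ h x * (∫ t in a..x, h t) ^ r) :
    IsSubprofileOn r h q (fun x => r / (1 + r) * ∫ t in a..x, h t) (Ioo a b) := by
  intro x hx
  have hHx := hH x hx
  have hderiv := (hasDerivAt_integral_of_mem_Ioo hh hhi hx).const_mul (r / (1 + r))
  refine ⟨by positivity, hderiv.differentiableAt, ?_⟩
  rw [hderiv.deriv]
  have hκ : r / (1 + r) * h x + h x / (1 + r) = h x := by field_simp; ring
  have hrpow : q x * (r / (1 + r) * ∫ t in a..x, h t) ^ (-r) =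
      criticalConstant r * q x / (∫ t in a..x, h t) ^ r / (1 + r) := by
    rw [criticalConstant, Real.rpow_neg (by positivity), Real.mul_rpow (by positivity) hHx.le,
      Real.div_rpow hr.le (by positivity), Real.rpow_add (by positivity), Real.rpow_one]
    field_simp
  have hq : criticalConstant r * q x / (∫ t in a..x, h t) ^ r / (1 + r) ≤ h x / (1 + r) :=
    div_le_div_of_nonneg_right ((div_le_iff₀ (by positivity)).2 (hle x hx)) (by positivity)
  linarith

theorem IsProfileOn.exists_pos (hab : a < b) (hq : ∀ x ∈ Ioo a b, 0 < q x)
    (hw : IsProfileOn r h q w (Ioo a b)) (hwa : Tendsto w (𝓝[>] a) (𝓝 0)) :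
    ∃ x ∈ Ioo a b, 0 < h x := by
  by_contra! hh
  obtain ⟨x, hx⟩ := nonempty_Ioo.2 hab
  have hlt : -0 < -w x := lt_of_hasDerivAt_pos_of_tendsto (φ := fun y => -w y)
    (fun y hy => (hw y hy).2.fun_neg) (fun y hy => ?_) hwa.neg hx
  · linarith [(hw x hx).1]
  linarith [hh y hy, mul_pos (hq y hy) (Real.rpow_pos_of_pos (hw y hy).1 (-r))]

theorem IsProfileOn.le_mul_integral {t κ : ℝ} (hr : 0 ≤ r) (hh : ContinuousOn h (Ioo a b))
    (hhi : IntegrableOn h (Ioo a b)) (hq : ∀ x ∈ Ioo a b, 0 ≤ q x) (hκ : 0 < κ) (ht : 0 < t)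
    (hH : ∀ x ∈ Ioo a b, 0 < ∫ s in a..x, h s)
    (hle : ∀ x ∈ Ioo a b, h x * (∫ s in a..x, h s) ^ r ≤ κ * q x)
    (hw : IsProfileOn r h q w (Ioo a b)) (hwa : Tendsto w (𝓝[>] a) (𝓝 0))
    (hwt : ∀ x ∈ Ioo a b, w x ≤ t * ∫ s in a..x, h s) {x : ℝ} (hx : x ∈ Ioo a b) :
    w x ≤ (1 - (κ * t ^ r)⁻¹) * ∫ s in a..x, h s := by
  have hlim := ((tendsto_integral_nhdsGT (hx.1.trans hx.2) hhi).const_mul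
    (1 - (κ * t ^ r)⁻¹)).sub hwa
  rw [mul_zero, sub_zero] at hlim
  refine sub_nonneg.1 (le_of_hasDerivAt_nonneg_of_tendsto
    (φ := fun y => (1 - (κ * t ^ r)⁻¹) * (∫ s in a..y, h s) - w y)
    (fun y hy => ((hasDerivAt_integral_of_mem_Ioo hh hhi hy).const_mul _).fun_sub (hw y hy).2)
    (fun y hy => ?_) hlim hx)
  have hHy := hH y hy
  have hbound : (κ * t ^ r)⁻¹ * h y ≤ q y * w y ^ (-r) :=
    calc (κ * t ^ r)⁻¹ * h y
        = h y * (∫ s in a..y, h s) ^ r / κ * (t * ∫ s in a..y, h s) ^ (-r) := by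
          rw [Real.rpow_neg (by positivity), Real.mul_rpow ht.le hHy.le]
          field_simp
      _ ≤ q y * (t * ∫ s in a..y, h s) ^ (-r) :=
          mul_le_mul_of_nonneg_right ((div_le_iff₀' hκ).2 (hle y hy)) (by positivity)
      _ ≤ q y * w y ^ (-r) := mul_le_mul_of_nonneg_left
          (Real.rpow_le_rpow_of_nonpos (hw y hy).1 (hwt y hy) (neg_nonpos.2 hr)) (hq y hy)
  linarith

/-- The least `t` with `w ≤ t H`, where `H' = h`, satisfies `(1 - t) tʳ ≥ 1 / κ`. -/
theorem IsProfileOn.criticalConstant_le {κ : ℝ} (hr : 0 < r) (hab : a < b)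
    (hh : ContinuousOn h (Ioo a b)) (hhi : IntegrableOn h (Ioo a b))
    (hq : ∀ x ∈ Ioo a b, 0 < q x) (hκ : 0 < κ)
    (hle : ∀ x ∈ Ioo a b, h x * (∫ s in a..x, h s) ^ r ≤ κ * q x)
    (hw : IsProfileOn r h q w (Ioo a b)) (hwa : Tendsto w (𝓝[>] a) (𝓝 0)) :
    criticalConstant r ≤ κ := by
  have hwH : ∀ x ∈ Ioo a b, w x < ∫ s in a..x, h s := fun x hx => hw.lt_integral hh hhi hq hwa hx
  have hH : ∀ x ∈ Ioo a b, 0 < ∫ s in a..x, h s := fun x hx => (hw x hx).1.trans (hwH x hx)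
  obtain ⟨y, hy⟩ := nonempty_Ioo.2 hab
  set S : Set ℝ := {t | ∀ x ∈ Ioo a b, w x ≤ t * ∫ s in a..x, h s}
  have hpos : ∀ t ∈ S, 0 < t := fun t ht =>
    pos_of_mul_pos_left ((hw y hy).1.trans_le (ht y hy)) (hH y hy).le
  have hbdd : BddBelow S := ⟨0, fun t ht => (hpos t ht).le⟩
  have hone : 1 ∈ S := fun x hx => by simpa only [one_mul] using (hwH x hx).le
  have hmem : sInf S ∈ S := fun x hx => (div_le_iff₀ (hH x hx)).1
    (le_csInf ⟨1, hone⟩ fun t ht => (div_le_iff₀ (hH x hx)).2 (ht x hx))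
  have ht₀ := hpos _ hmem
  have hle_sub : sInf S ≤ 1 - (κ * sInf S ^ r)⁻¹ := csInf_le hbdd fun x hx =>
    hw.le_mul_integral hr.le hh hhi (fun x hx => (hq x hx).le) hκ ht₀ hH hle hwa hmem hx
  have hge : 1 ≤ κ * ((1 - sInf S) * sInf S ^ r) := by
    have hinv : (κ * sInf S ^ r)⁻¹ ≤ 1 - sInf S := by linarith
    rw [inv_le_iff_one_le_mul₀ (by positivity)] at hinv
    linarith
  have hpos' : 0 < (1 - sInf S) * sInf S ^ r := pos_of_mul_pos_right (one_pos.trans_le hge) hκ.le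
  exact le_of_mul_le_mul_right
    ((criticalConstant_mul_le_one hr ht₀.le (csInf_le hbdd hone)).trans hge) hpos'

end Criteria

section CriteriaExponent

variable {p a b : ℝ} {h d ρ w : ℝ → ℝ}

theorem rpow_mul_rpow_one_div_sub_one (hp : 1 < p) (ha : 0 ≤ a) (hb : 0 ≤ b) :
    (a ^ (p - 1) * b) ^ (1 / (p - 1)) = a * b ^ (1 / (p - 1)) := by
  rw [Real.mul_rpow (Real.rpow_nonneg ha _) hb, one_div,
    Real.rpow_rpow_inv ha (sub_pos.2 hp).ne']

theorem rpow_one_div_eq_criticalConstant (hp : 1 < p) :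
    (p ^ p / (p - 1) ^ (p - 1)) ^ (1 / (p - 1)) = criticalConstant (1 / (p - 1)) := by
  have hp₀ : 0 < p := one_pos.trans hp
  have hp₁ : 0 < p - 1 := sub_pos.2 hp
  have hadd : 1 + 1 / (p - 1) = p / (p - 1) := by field_simp; ring
  rw [criticalConstant, hadd, Real.div_rpow (by positivity) (by positivity),
    ← Real.rpow_mul hp₀.le, ← Real.rpow_mul hp₁.le, mul_one_div, mul_one_div, div_self hp₁.ne',
    Real.rpow_one, Real.div_rpow hp₀.le hp₁.le, Real.div_rpow zero_le_one hp₁.le, Real.one_rpow]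
  have hsplit : (p - 1) ^ (p / (p - 1)) = (p - 1) * (p - 1) ^ (1 / (p - 1)) := by
    rw [← hadd, Real.rpow_add hp₁, Real.rpow_one]
  rw [hsplit]
  field_simp

theorem isSubprofileOn_mul_integral_of_rpow_le (hp : 1 < p) (hh : ContinuousOn h (Ioo a b))
    (hhi : IntegrableOn h (Ioo a b)) (hd : ∀ x ∈ Ioo a b, 0 < d x) (hρ : ∀ x ∈ Ioo a b, 0 < ρ x)
    (hh₀ : ∀ x ∈ Ioo a b, 0 ≤ h x)
    (hle : ∀ x ∈ Ioo a b, p ^ p / (p - 1) ^ (p - 1) * d x * ρ x ^ (p - 1) ≤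
      h x ^ (p - 1) * ∫ t in a..x, h t) :
    IsSubprofileOn (1 / (p - 1)) h (fun x => ρ x * d x ^ (1 / (p - 1)))
      (fun x => 1 / (p - 1) / (1 + 1 / (p - 1)) * ∫ t in a..x, h t) (Ioo a b) := by
  have : 0 < p := one_pos.trans hp
  have hp₁ : 0 < p - 1 := sub_pos.2 hp
  have hH : ∀ x ∈ Ioo a b, 0 < ∫ t in a..x, h t := fun x hx => by
    have hdx := hd x hx
    have hρx := hρ x hx
    exact pos_of_mul_pos_right (lt_of_lt_of_le (by positivity) (hle x hx))
      (Real.rpow_nonneg (hh₀ x hx) _)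
  refine isSubprofileOn_mul_integral (one_div_pos.2 hp₁) hh hhi hH fun x hx => ?_
  have hdx := hd x hx
  have hρx := hρ x hx
  have hrpow := Real.rpow_le_rpow (by positivity) (hle x hx) (one_div_pos.2 hp₁).le
  rwa [rpow_mul_rpow_one_div_sub_one hp (hh₀ x hx) (hH x hx).le, mul_comm (_ * d x),
    rpow_mul_rpow_one_div_sub_one hp hρx.le (by positivity),
    Real.mul_rpow (by positivity) hdx.le, rpow_one_div_eq_criticalConstant hp,
    mul_left_comm] at hrpow

theorem IsProfileOn.le_of_rpow_mul_integral_le {l : ℝ} (hp : 1 < p) (hab : a < b)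
    (hh : ContinuousOn h (Ioo a b)) (hhi : IntegrableOn h (Ioo a b))
    (hd : ∀ x ∈ Ioo a b, 0 < d x) (hρ : ∀ x ∈ Ioo a b, 0 < ρ x) (hh₀ : ∀ x ∈ Ioo a b, 0 ≤ h x)
    (hle : ∀ x ∈ Ioo a b, h x ^ (p - 1) * (∫ t in a..x, h t) ≤ l * d x * ρ x ^ (p - 1))
    (hw : IsProfileOn (1 / (p - 1)) h (fun x => ρ x * d x ^ (1 / (p - 1))) w (Ioo a b))
    (hwa : Tendsto w (𝓝[>] a) (𝓝 0)) : p ^ p / (p - 1) ^ (p - 1) ≤ l := by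
  have : 0 < p := one_pos.trans hp
  have hp₁ : 0 < p - 1 := sub_pos.2 hp
  have hr : 0 < 1 / (p - 1) := one_div_pos.2 hp₁
  set K := p ^ p / (p - 1) ^ (p - 1)
  have hK : 0 < K := by positivity
  have hl : 0 < max l (K / 2) := lt_max_of_lt_right (half_pos hK)
  have hq : ∀ x ∈ Ioo a b, 0 < ρ x * d x ^ (1 / (p - 1)) :=
    fun x hx => mul_pos (hρ x hx) (Real.rpow_pos_of_pos (hd x hx) _)
  suffices K ≤ max l (K / 2) from (le_max_iff.1 this).resolve_right (half_lt_self hK).not_ge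
  rw [← Real.rpow_le_rpow_iff hK.le hl.le hr, rpow_one_div_eq_criticalConstant hp]
  refine hw.criticalConstant_le hr hab hh hhi hq (Real.rpow_pos_of_pos hl _) (fun x hx => ?_) hwa
  have hdx := hd x hx
  have hρx := hρ x hx
  have hHx := (hw x hx).1.le.trans (hw.lt_integral hh hhi hq hwa hx).le
  have hle' : h x ^ (p - 1) * (∫ t in a..x, h t) ≤ ρ x ^ (p - 1) * (max l (K / 2) * d x) :=
    calc _ ≤ l * d x * ρ x ^ (p - 1) := hle x hx
      _ = ρ x ^ (p - 1) * (l * d x) := mul_comm _ _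
      _ ≤ _ := by gcongr; exact le_max_left _ _
  have hrpow := Real.rpow_le_rpow (mul_nonneg (Real.rpow_nonneg (hh₀ x hx) _) hHx) hle' hr.le
  rwa [rpow_mul_rpow_one_div_sub_one hp (hh₀ x hx) hHx,
    rpow_mul_rpow_one_div_sub_one hp hρx.le (by positivity), Real.mul_rpow hl.le hdx.le,
    mul_left_comm] at hrpow

end CriteriaExponent

section OpenInterval

theorem isOpen_openInterval (α β : EReal) : IsOpen (openInterval α β) :=
  isOpen_Ioo.preimage continuous_coe_real_ereal

theorem ordConnected_openInterval (α β : EReal) : (openInterval α β).OrdConnected :=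
  (ordConnected_Ioo (a := α) (b := β)).preimage_mono EReal.coe_strictMono.monotone

theorem openInterval_coe (a b : ℝ) : openInterval a b = Ioo a b := by
  ext t
  exact and_congr EReal.coe_lt_coe_iff EReal.coe_lt_coe_iff

theorem openInterval_nonempty {α β : EReal} (h : α < β) : (openInterval α β).Nonempty :=
  EReal.lt_iff_exists_real_btwn.1 h

theorem exists_openInterval_eq {I : Set ℝ} (hI : IsOpen I) (hI' : I.OrdConnected)
    (hne : I.Nonempty) : ∃ α β : EReal, α < β ∧ openInterval α β = I := by
  set α : EReal := sInf ((↑) '' I)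
  set β : EReal := sSup ((↑) '' I)
  have hsub : I ⊆ openInterval α β := by
    intro t ht
    obtain ⟨l, hl, hlt⟩ := (Eventually.and
      (nhdsWithin_le_nhds (s := Iio t) (hI.mem_nhds ht)) self_mem_nhdsWithin).exists
    obtain ⟨m, hm, htm⟩ := (Eventually.and
      (nhdsWithin_le_nhds (s := Ioi t) (hI.mem_nhds ht)) self_mem_nhdsWithin).exists
    exact ⟨(sInf_le (mem_image_of_mem _ hl)).trans_lt (EReal.coe_lt_coe_iff.2 hlt),
      (EReal.coe_lt_coe_iff.2 htm).trans_le (le_sSup (mem_image_of_mem _ hm))⟩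
  obtain ⟨t, ht⟩ := hne
  refine ⟨α, β, (hsub ht).1.trans (hsub ht).2, Subset.antisymm (fun s hs => ?_) hsub⟩
  obtain ⟨_, ⟨l, hl, rfl⟩, hls⟩ := sInf_lt_iff.1 hs.1
  obtain ⟨_, ⟨m, hm, rfl⟩, hsm⟩ := lt_sSup_iff.1 hs.2
  exact hI'.out hl hm ⟨(EReal.coe_lt_coe_iff.1 hls).le, (EReal.coe_lt_coe_iff.1 hsm).le⟩

theorem rightOf_coe (a : ℝ) : rightOf a = 𝓝[>] a := by
  rw [rightOf, nhdsWithin, comap_inf, comap_principal,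
    ← EReal.isOpenEmbedding_coe.isInducing.nhds_eq_comap, EReal.preimage_coe_Ioi]
  rfl

theorem leftOf_coe (a : ℝ) : leftOf a = 𝓝[<] a := by
  rw [leftOf, nhdsWithin, comap_inf, comap_principal,
    ← EReal.isOpenEmbedding_coe.isInducing.nhds_eq_comap, EReal.preimage_coe_Iio]
  rfl

theorem hasBasis_rightOf {α β : EReal} (h : α < β) :
    (rightOf α).HasBasis (· ∈ openInterval α β) (openInterval α ·) := by
  refine ((nhdsGT_basis_of_exists_gt ⟨β, h⟩).comap _).to_hasBasis (fun γ hγ => ?_)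
    fun t ht => ⟨t, ht.1, Subset.rfl⟩
  obtain ⟨t, hαt, htγ⟩ := EReal.lt_iff_exists_real_btwn.1 (lt_min hγ h)
  exact ⟨t, ⟨hαt, htγ.trans_le (min_le_right _ _)⟩,
    fun s hs => ⟨hs.1, hs.2.trans (htγ.trans_le (min_le_left _ _))⟩⟩

theorem hasBasis_leftOf {α β : EReal} (h : α < β) :
    (leftOf β).HasBasis (· ∈ openInterval α β) (openInterval · β) := by
  refine ((nhdsLT_basis_of_exists_lt ⟨α, h⟩).comap _).to_hasBasis (fun γ hγ => ?_)
    fun t ht => ⟨t, ht.2, Subset.rfl⟩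
  obtain ⟨t, hγt, htβ⟩ := EReal.lt_iff_exists_real_btwn.1 (max_lt hγ h)
  exact ⟨t, ⟨(le_max_right _ _).trans_lt hγt, htβ⟩,
    fun s hs => ⟨((le_max_left _ _).trans_lt hγt).trans hs.1, hs.2⟩⟩

theorem neBot_rightOf {α β : EReal} (h : α < β) : (rightOf α).NeBot :=
  (hasBasis_rightOf h).neBot_iff.2 fun ht => openInterval_nonempty ht.1

theorem neBot_leftOf {α β : EReal} (h : α < β) : (leftOf β).NeBot :=
  (hasBasis_leftOf h).neBot_iff.2 fun ht => openInterval_nonempty ht.2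

theorem openInterval_mem_rightOf {α β : EReal} (h : α < β) : openInterval α β ∈ rightOf α :=
  preimage_mem_comap (Ioo_mem_nhdsGT h)

theorem openInterval_mem_leftOf {α β : EReal} (h : α < β) : openInterval α β ∈ leftOf β :=
  preimage_mem_comap (Ioo_mem_nhdsLT h)

theorem tendsto_rightOf_leftOf_of_strictAntiOn {u : ℝ → ℝ} {α β γ δ : EReal}
    (hu : StrictAntiOn u (openInterval α β)) (hαβ : α < β) (hγδ : γ < δ)
    (hbij : BijOn u (openInterval α β) (openInterval γ δ)) :
    Tendsto u (rightOf α) (leftOf δ) := by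
  refine ((hasBasis_rightOf hαβ).tendsto_iff (hasBasis_leftOf hγδ)).2 fun x hx => ?_
  obtain ⟨t, ht, rfl⟩ := hbij.surjOn hx
  refine ⟨t, ht, fun s hs => ?_⟩
  have hsI : s ∈ openInterval α β := ⟨hs.1, hs.2.trans ht.2⟩
  exact ⟨EReal.coe_lt_coe_iff.2 (hu hsI ht (EReal.coe_lt_coe_iff.1 hs.2)), (hbij.mapsTo hsI).2⟩

theorem tendsto_leftOf_rightOf_of_strictAntiOn {u : ℝ → ℝ} {α β γ δ : EReal}
    (hu : StrictAntiOn u (openInterval α β)) (hαβ : α < β) (hγδ : γ < δ)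
    (hbij : BijOn u (openInterval α β) (openInterval γ δ)) :
    Tendsto u (leftOf β) (rightOf γ) := by
  refine ((hasBasis_leftOf hαβ).tendsto_iff (hasBasis_rightOf hγδ)).2 fun x hx => ?_
  obtain ⟨t, ht, rfl⟩ := hbij.surjOn hx
  refine ⟨t, ht, fun s hs => ?_⟩
  have hsI : s ∈ openInterval α β := ⟨ht.1.trans hs.1, hs.2⟩
  exact ⟨(hbij.mapsTo hsI).1, EReal.coe_lt_coe_iff.2 (hu ht hsI (EReal.coe_lt_coe_iff.1 hs.1))⟩

end OpenInterval

theorem contDiffOn_one_of_hasDerivAt {𝕜 F : Type*} [NontriviallyNormedField 𝕜]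
    [NormedAddCommGroup F] [NormedSpace 𝕜 F] {φ φ' : 𝕜 → F} {I : Set 𝕜} (hI : IsOpen I)
    (hφ : ∀ t ∈ I, HasDerivAt φ (φ' t) t) (hφ' : ContinuousOn φ' I) : ContDiffOn 𝕜 1 φ I :=
  (contDiffOn_one_iff_derivWithin hI.uniqueDiffOn).2
    ⟨fun t ht => (hφ t ht).differentiableAt.differentiableWithinAt, hφ'.congr fun t ht =>
      (hφ t ht).hasDerivWithinAt.derivWithin (hI.uniqueDiffWithinAt ht)⟩

theorem exists_openPartialHomeomorph_of_injOn {𝕜 : Type*} [RCLike 𝕜] {u : 𝕜 → 𝕜}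
    {I : Set 𝕜} (hI : IsOpen I) (hinj : InjOn u I) (hu : ContDiffOn 𝕜 1 u I)
    (hu' : ∀ t ∈ I, deriv u t ≠ 0) :
    ∃ e : OpenPartialHomeomorph 𝕜 𝕜, e.source = I ∧ ⇑e = u := by
  have hopen : IsOpenMap (I.domRestrict u) := by
    refine isOpenMap_iff_nhds_le.2 fun t => ?_
    have hut := (hu.contDiffAt (hI.mem_nhds t.2)).hasStrictDerivAt one_ne_zero
    rw [domRestrict_apply, ← hut.map_nhds_eq (hu' t t.2),
      ← map_nhds_subtype_coe_eq_nhds t.2 (hI.mem_nhds t.2), map_map]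
    rfl
  exact ⟨.ofContinuousOpenRestrict (hinj.toPartialEquiv u I) hu.continuousOn hopen hI, rfl, rfl⟩

theorem strictAntiOn_of_hasDerivAt_neg {I : Set ℝ} (hI : I.OrdConnected) {u u' : ℝ → ℝ}
    (hu : ∀ t ∈ I, HasDerivAt u (u' t) t) (hu' : ∀ t ∈ I, u' t < 0) : StrictAntiOn u I := by
  refine strictAntiOn_of_deriv_neg hI.convex
    (fun t ht => (hu t ht).continuousAt.continuousWithinAt) fun t ht => ?_
  rw [(hu t (interior_subset ht)).deriv]
  exact hu' t (interior_subset ht)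

theorem exists_bijOn_openInterval_hasDerivAt_neg {a b : ℝ} (hab : a < b) {v : ℝ → ℝ}
    (hvc : ContinuousOn v (Ioo a b)) (hv : ∀ x ∈ Ioo a b, 0 < v x) :
    ∃ (α β : EReal) (u : ℝ → ℝ), α < β ∧ BijOn u (openInterval α β) (Ioo a b) ∧
      ∀ t ∈ openInterval α β, HasDerivAt u (-v (u t)) t := by
  have hvc' : ContinuousOn (fun x => -(v x)⁻¹) (Ioo a b) := (hvc.inv₀ fun x hx => (hv x hx).ne').neg
  obtain ⟨c, hc⟩ := nonempty_Ioo.2 hab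
  have hT : ∀ x ∈ Ioo a b, HasDerivAt (fun x => ∫ y in c..x, -(v y)⁻¹) (-(v x)⁻¹) x := by
    intro x hx
    have hsub : uIcc c x ⊆ Ioo a b := ordConnected_Ioo.uIcc_subset hc hx
    exact intervalIntegral.integral_hasDerivAt_right (hvc'.mono hsub).intervalIntegrable
      (hvc'.stronglyMeasurableAtFilter isOpen_Ioo x hx) (hvc'.continuousAt (isOpen_Ioo.mem_nhds hx))
  have hT' : ∀ x ∈ Ioo a b, -(v x)⁻¹ < 0 := fun x hx => neg_neg_of_pos (inv_pos.2 (hv x hx))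
  obtain ⟨e, hes, he⟩ := exists_openPartialHomeomorph_of_injOn isOpen_Ioo
    (strictAntiOn_of_hasDerivAt_neg ordConnected_Ioo hT hT').injOn
    (contDiffOn_one_of_hasDerivAt isOpen_Ioo hT hvc')
    (fun x hx => (hT x hx).deriv.trans_ne (hT' x hx).ne)
  have hconn : e.target.OrdConnected := by
    rw [← e.image_source_eq_target, hes]
    exact (isPreconnected_Ioo.image e (hes ▸ e.continuousOn)).ordConnected
  obtain ⟨α, β, hαβ, hI⟩ := exists_openInterval_eq e.open_target hconn
    ⟨e c, e.map_source (hes ▸ hc)⟩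
  refine ⟨α, β, e.symm, hαβ, hI ▸ hes ▸ e.symm.bijOn, fun t ht => ?_⟩
  have hx : e.symm t ∈ Ioo a b := hes ▸ e.map_target (hI ▸ ht)
  simpa only [inv_neg, inv_inv] using
    e.hasDerivAt_symm (hI ▸ ht) (hT' _ hx).ne (he ▸ hT _ hx)

theorem neg_of_nonpos_of_deriv_neg {φ : ℝ → ℝ} {I : Set ℝ} (hI : I.OrdConnected)
    (hφ : ∀ t ∈ I, DifferentiableAt ℝ φ t) (hφ' : ∀ t ∈ I, φ t = 0 → deriv φ t < 0)
    {s t : ℝ} (hs : s ∈ I) (ht : t ∈ I) (hst : s < t) (hφs : φ s ≤ 0) : φ t < 0 := by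
  have hsub : Icc s t ⊆ I := hI.out hs ht
  have hle : ∀ x ∈ Icc s t, φ x ≤ 0 := fun x hx =>
    image_le_of_deriv_right_lt_deriv_boundary (f' := deriv φ) (B := 0) (B' := 0)
      (fun y hy => (hφ y (hsub hy)).continuousAt.continuousWithinAt)
      (fun y hy => (hφ y (hsub (Ico_subset_Icc_self hy))).hasDerivAt.hasDerivWithinAt)
      hφs (fun y => hasDerivAt_const y 0)
      (fun y hy => hφ' y (hsub (Ico_subset_Icc_self hy))) hx
  refine (hle t ⟨hst.le, le_rfl⟩).lt_of_ne fun h₀ => ?_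
  obtain ⟨x, hsign, hx⟩ := (((eventually_nhdsWithin_sign_eq_of_deriv_neg (hφ' t ht h₀)
    h₀).filter_mono nhdsWithin_le_nhds).and (Ioo_mem_nhdsLT hst)).exists
  rw [sign_pos (sub_pos.2 hx.2), sign_eq_one_iff] at hsign
  exact hsign.not_ge (hle x (Ioo_subset_Icc_self hx))

section Flux

variable {p : ℝ} {d u : ℝ → ℝ} {t : ℝ}

theorem sign_flux (hd : 0 < d (u t)) :
    SignType.sign (flux p d u t) = SignType.sign (deriv u t) := by
  rcases eq_or_ne (deriv u t) 0 with h | h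
  · simp only [flux, h, mul_zero]
  · have habs : 0 < |deriv u t| ^ (p - 2) := Real.rpow_pos_of_pos (abs_pos.2 h) _
    rw [flux, sign_mul, sign_pos (mul_pos hd habs), one_mul]

theorem flux_eq_neg (h : deriv u t < 0) :
    flux p d u t = -(d (u t) * (-deriv u t) ^ (p - 1)) := by
  have hpow : (-deriv u t) ^ (p - 1) = (-deriv u t) ^ (p - 2) * -deriv u t := by
    rw [← Real.rpow_add_one (neg_pos.2 h).ne']
    ring_nf
  rw [flux, abs_of_neg h, hpow]
  ring

theorem rpow_mul_flux_rpow_neg {D y : ℝ} (hp : 1 < p) (hD : 0 < D) (hy : 0 < y) :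
    D ^ (1 / (p - 1)) * (D * y ^ (p - 1)) ^ (-(1 / (p - 1))) = y⁻¹ := by
  have hp₁ : p - 1 ≠ 0 := (sub_pos.2 hp).ne'
  rw [Real.mul_rpow hD.le (Real.rpow_nonneg hy.le _), ← mul_assoc, ← Real.rpow_add hD,
    add_neg_cancel, Real.rpow_zero, one_mul, ← Real.rpow_mul hy.le, mul_neg,
    mul_one_div_cancel hp₁, Real.rpow_neg_one]

end Flux

namespace IsTravellingWave

variable {p c : ℝ} {f g d ρ u : ℝ → ℝ} {α β : EReal}

theorem hasDerivAt (hu : IsTravellingWave p f g d ρ c α β u) {t : ℝ}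
    (ht : t ∈ openInterval α β) : HasDerivAt u (deriv u t) t :=
  (hu.contDiffOn.differentiableOn one_ne_zero).hasDerivAt
    ((isOpen_openInterval α β).mem_nhds ht)

theorem hasDerivAt_flux (hu : IsTravellingWave p f g d ρ c α β u) {t : ℝ}
    (ht : t ∈ openInterval α β) : HasDerivAt (flux p d u) (deriv (flux p d u) t) t :=
  (hu.contDiffOn_flux.differentiableOn one_ne_zero).hasDerivAt
    ((isOpen_openInterval α β).mem_nhds ht)

theorem deriv_flux_neg (hu : IsTravellingWave p f g d ρ c α β u)
    (hρ : ∀ x ∈ Ioo (0 : ℝ) 1, 0 < ρ x) {t : ℝ} (ht : t ∈ openInterval α β)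
    (h : deriv u t = 0) : deriv (flux p d u) t < 0 := by
  have heq := hu.equation t ht
  rw [h, mul_zero, add_zero] at heq
  exact (eq_neg_of_add_eq_zero_left heq).trans_lt (neg_neg_of_pos (hρ _ (hu.mem_Ioo t ht)))

theorem deriv_neg (hu : IsTravellingWave p f g d ρ c α β u)
    (hρ : ∀ x ∈ Ioo (0 : ℝ) 1, 0 < ρ x) (hd : ∀ x ∈ Ioo (0 : ℝ) 1, 0 < d x) {t : ℝ}
    (ht : t ∈ openInterval α β) : deriv u t < 0 := by
  have hsign : ∀ s ∈ openInterval α β, SignType.sign (flux p d u s) = SignType.sign (deriv u s) :=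
    fun s hs => sign_flux (hd _ (hu.mem_Ioo s hs))
  by_contra! hut
  have hpos : ∀ s ∈ openInterval α β, s < t → 0 ≤ deriv u s := by
    intro s hs hst
    by_contra! hus
    rw [← sign_eq_neg_one_iff, ← hsign s hs, sign_eq_neg_one_iff] at hus
    refine hut.not_gt (sign_eq_neg_one_iff.1 ((hsign t ht).symm.trans (sign_eq_neg_one_iff.2 ?_)))
    refine neg_of_nonpos_of_deriv_neg (ordConnected_openInterval α β)
      (fun x hx => (hu.hasDerivAt_flux hx).differentiableAt) (fun x hx hφx => ?_) hs ht hst hus.le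
    rw [← sign_eq_zero_iff, hsign x hx, sign_eq_zero_iff] at hφx
    exact hu.deriv_flux_neg hρ hx hφx
  have hsub : ∀ s ∈ openInterval α t, s ∈ openInterval α β ∧ s < t := fun s hs =>
    ⟨⟨hs.1, hs.2.trans ht.2⟩, EReal.coe_lt_coe_iff.1 hs.2⟩
  have hmono : MonotoneOn u (openInterval α t) := by
    refine monotoneOn_of_deriv_nonneg (ordConnected_openInterval _ _).convex
      (hu.contDiffOn.continuousOn.mono fun s hs => (hsub s hs).1)
      (fun s hs => ?_) fun s hs => ?_
    all_goals obtain ⟨hsI, hst⟩ := hsub s (interior_subset hs)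
    · exact (hu.hasDerivAt hsI).differentiableAt.differentiableWithinAt
    · exact hpos s hsI hst
  obtain ⟨s, hs⟩ := openInterval_nonempty ht.1
  have := neBot_rightOf hu.lt
  refine (hu.mem_Ioo s (hsub s hs).1).2.not_ge (le_of_tendsto hu.tendsto_left ?_)
  filter_upwards [openInterval_mem_rightOf hs.1] with x hx
  exact hmono ⟨hx.1, hx.2.trans hs.2⟩ hs (EReal.coe_lt_coe_iff.1 hx.2).le

theorem bijOn (hu : IsTravellingWave p f g d ρ c α β u) (hinj : InjOn u (openInterval α β)) :
    BijOn u (openInterval α β) (Ioo 0 1) := by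
  have hαβ := hu.lt
  have := neBot_rightOf hαβ
  have := neBot_leftOf hαβ
  refine ⟨hu.mem_Ioo, hinj, ?_⟩
  exact (ordConnected_openInterval α β).isPreconnected.intermediate_value_Ioo
    (le_principal_iff.2 (openInterval_mem_leftOf hαβ))
    (le_principal_iff.2 (openInterval_mem_rightOf hαβ))
    hu.contDiffOn.continuousOn hu.tendsto_right hu.tendsto_left

theorem hasDerivAt_neg_flux_comp (hp : 1 < p) (hu : IsTravellingWave p f g d ρ c α β u)
    {T : ℝ → ℝ} {x : ℝ} (hdx : 0 < d x) (hTx : T x ∈ openInterval α β) (huT : u (T x) = x)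
    (hneg : deriv u (T x) < 0) (hT : HasDerivAt T (deriv u (T x))⁻¹ x) :
    HasDerivAt (fun y => -flux p d u (T y)) (c * g x - f x -
      ρ x * d x ^ (1 / (p - 1)) * (-flux p d u (T x)) ^ (-(1 / (p - 1)))) x := by
  convert! ((hu.hasDerivAt_flux hTx).comp x hT).neg using 1
  have heq := hu.equation _ hTx
  rw [huT] at heq
  rw [flux_eq_neg hneg, neg_neg, huT, mul_assoc, rpow_mul_flux_rpow_neg hp hdx (neg_pos.2 hneg)]
  field_simp [hneg.ne]
  linarith

theorem exists_isConnectingProfile (hp : 1 < p) (hρ : ∀ x ∈ Ioo (0 : ℝ) 1, 0 < ρ x)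
    (hd : ∀ x ∈ Ioo (0 : ℝ) 1, 0 < d x) (hu : IsTravellingWave p f g d ρ c α β u) :
    ∃ w, IsConnectingProfile (1 / (p - 1)) (fun x => c * g x - f x)
      (fun x => ρ x * d x ^ (1 / (p - 1))) w := by
  have hneg : ∀ t ∈ openInterval α β, deriv u t < 0 := fun t ht => hu.deriv_neg hρ hd ht
  have hanti := strictAntiOn_of_hasDerivAt_neg (ordConnected_openInterval α β)
    (fun t ht => hu.hasDerivAt ht) hneg
  have hbij := hu.bijOn hanti.injOn
  obtain ⟨e, hes, rfl⟩ := exists_openPartialHomeomorph_of_injOn (isOpen_openInterval α β)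
    hanti.injOn hu.contDiffOn fun t ht => (hneg t ht).ne
  have het : e.target = Ioo 0 1 := by rw [← e.image_source_eq_target, hes, hbij.image_eq]
  have hsymm : BijOn e.symm (Ioo 0 1) (openInterval α β) := het ▸ hes ▸ e.symm.bijOn
  have hderiv : ∀ x ∈ Ioo (0 : ℝ) 1, HasDerivAt e.symm (deriv e (e.symm x))⁻¹ x := fun x hx =>
    e.hasDerivAt_symm (het ▸ hx) (hneg _ (hsymm.mapsTo hx)).ne (hu.hasDerivAt (hsymm.mapsTo hx))
  have hsymm_anti : StrictAntiOn e.symm (Ioo 0 1) :=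
    strictAntiOn_of_hasDerivAt_neg ordConnected_Ioo hderiv
      fun x hx => inv_lt_zero.2 (hneg _ (hsymm.mapsTo hx))
  have h₀₁ : ((0 : ℝ) : EReal) < (1 : ℝ) := EReal.coe_lt_coe_iff.2 one_pos
  rw [← openInterval_coe] at hsymm hsymm_anti
  refine ⟨fun x => -flux p d e (e.symm x), fun x hx => ?_, ?_, ?_⟩
  · have ht : e.symm x ∈ openInterval α β := hsymm.mapsTo (openInterval_coe 0 1 ▸ hx)
    have hx' : e (e.symm x) = x := e.right_inv (het ▸ hx)
    have hflux : flux p d e (e.symm x) < 0 := by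
      rw [← sign_eq_neg_one_iff, sign_flux (hx'.symm ▸ hd x hx), sign_eq_neg_one_iff]
      exact hneg _ ht
    exact ⟨neg_pos.2 hflux,
      hu.hasDerivAt_neg_flux_comp hp (hd x hx) ht hx' (hneg _ ht) (hderiv x hx)⟩
  · rw [← rightOf_coe]
    simpa only [neg_zero, Function.comp_apply] using (hu.flux_right.comp
      (tendsto_rightOf_leftOf_of_strictAntiOn hsymm_anti h₀₁ hu.lt hsymm)).neg
  · rw [← leftOf_coe]
    simpa only [neg_zero, Function.comp_apply] using (hu.flux_left.comp
      (tendsto_leftOf_rightOf_of_strictAntiOn hsymm_anti h₀₁ hu.lt hsymm)).neg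

end IsTravellingWave

namespace IsConnectingProfile

variable {p c : ℝ} {f g d ρ u w : ℝ → ℝ} {α β : EReal}

theorem flux_eq_neg (hp : 1 < p) (hd : ∀ x ∈ Ioo (0 : ℝ) 1, 0 < d x)
    (hw : ∀ x ∈ Ioo (0 : ℝ) 1, 0 < w x) {t : ℝ} (ht : u t ∈ Ioo (0 : ℝ) 1)
    (hu : HasDerivAt u (-(w (u t) / d (u t)) ^ (1 / (p - 1))) t) :
    flux p d u t = -w (u t) := by
  have hdu := hd _ ht
  have hquot : 0 < w (u t) / d (u t) := div_pos (hw _ ht) hdu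
  have hneg : deriv u t < 0 := hu.deriv.trans_lt (neg_neg_of_pos (Real.rpow_pos_of_pos hquot _))
  rw [_root_.flux_eq_neg hneg, hu.deriv, neg_neg, ← Real.rpow_mul hquot.le,
    one_div_mul_cancel (sub_pos.2 hp).ne', Real.rpow_one, mul_div_cancel₀ _ hdu.ne']

theorem hasDerivAt_flux (hp : 1 < p) (hd : ∀ x ∈ Ioo (0 : ℝ) 1, 0 < d x)
    (hw : IsConnectingProfile (1 / (p - 1)) (fun x => c * g x - f x)
      (fun x => ρ x * d x ^ (1 / (p - 1))) w)
    (hmaps : MapsTo u (openInterval α β) (Ioo 0 1))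
    (hu : ∀ t ∈ openInterval α β, HasDerivAt u (-(w (u t) / d (u t)) ^ (1 / (p - 1))) t) {t : ℝ}
    (ht : t ∈ openInterval α β) :
    HasDerivAt (flux p d u)
      ((c * g (u t) - f (u t)) * (w (u t) / d (u t)) ^ (1 / (p - 1)) - ρ (u t)) t := by
  have hflux : EqOn (flux p d u) (fun s => -w (u s)) (openInterval α β) := fun s hs =>
    flux_eq_neg hp hd (fun x hx => (hw.isProfileOn x hx).1) (hmaps hs) (hu s hs)
  obtain ⟨hwu, hwu'⟩ := hw.isProfileOn _ (hmaps ht)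
  have hdu := hd _ (hmaps ht)
  convert! ((hwu'.comp t (hu t ht)).neg).congr_of_eventuallyEq
    (hflux.eventuallyEq_of_mem ((isOpen_openInterval α β).mem_nhds ht)) using 1
  have := Real.rpow_pos_of_pos hwu (1 / (p - 1))
  have := Real.rpow_pos_of_pos hdu (1 / (p - 1))
  rw [Real.div_rpow hwu.le hdu.le, Real.rpow_neg hwu.le]
  field_simp

theorem isTravellingWave (hp : 1 < p) (hf : ContinuousOn f (Ioo 0 1))
    (hg : ContinuousOn g (Ioo 0 1)) (hρ : ContinuousOn ρ (Ioo 0 1))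
    (hdc : ContinuousOn d (Ioo 0 1)) (hd : ∀ x ∈ Ioo (0 : ℝ) 1, 0 < d x)
    (hw : IsConnectingProfile (1 / (p - 1)) (fun x => c * g x - f x)
      (fun x => ρ x * d x ^ (1 / (p - 1))) w) (hαβ : α < β)
    (hbij : BijOn u (openInterval α β) (Ioo 0 1))
    (hu : ∀ t ∈ openInterval α β, HasDerivAt u (-(w (u t) / d (u t)) ^ (1 / (p - 1))) t) :
    IsTravellingWave p f g d ρ c α β u := by
  have hI := isOpen_openInterval α β
  have hwpos : ∀ x ∈ Ioo (0 : ℝ) 1, 0 < w x := fun x hx => (hw.isProfileOn x hx).1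
  have hquot : ∀ x ∈ Ioo (0 : ℝ) 1, 0 < w x / d x := fun x hx => div_pos (hwpos x hx) (hd x hx)
  have huc : ContinuousOn u (openInterval α β) := HasDerivAt.continuousOn hu
  have hvc : ContinuousOn (fun x => (w x / d x) ^ (1 / (p - 1))) (Ioo 0 1) :=
    (hw.isProfileOn.continuousOn.div hdc fun x hx => (hd x hx).ne').rpow_const
      fun x hx => .inl (hquot x hx).ne'
  have hflux : EqOn (fun t => -w (u t)) (flux p d u) (openInterval α β) := fun t ht =>
    (flux_eq_neg hp hd hwpos (hbij.mapsTo ht) (hu t ht)).symm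
  have hflux' := fun t ht => hw.hasDerivAt_flux hp hd hbij.mapsTo hu (t := t) ht
  have hanti : StrictAntiOn u (openInterval α β) :=
    strictAntiOn_of_hasDerivAt_neg (ordConnected_openInterval α β) hu
      fun t ht => neg_neg_of_pos (Real.rpow_pos_of_pos (hquot _ (hbij.mapsTo ht)) _)
  have h₀₁ : ((0 : ℝ) : EReal) < (1 : ℝ) := EReal.coe_lt_coe_iff.2 one_pos
  have hu₁ : Tendsto u (rightOf α) (𝓝[<] 1) := leftOf_coe 1 ▸
    tendsto_rightOf_leftOf_of_strictAntiOn hanti hαβ h₀₁ (openInterval_coe 0 1 ▸ hbij)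
  have hu₀ : Tendsto u (leftOf β) (𝓝[>] 0) := rightOf_coe 0 ▸
    tendsto_leftOf_rightOf_of_strictAntiOn hanti hαβ h₀₁ (openInterval_coe 0 1 ▸ hbij)
  exact {
    lt := hαβ
    contDiffOn := contDiffOn_one_of_hasDerivAt hI hu (hvc.comp huc hbij.mapsTo).neg
    mem_Ioo := hbij.mapsTo
    contDiffOn_flux := contDiffOn_one_of_hasDerivAt hI hflux'
      ((((continuousOn_const.mul hg).sub hf).mul hvc |>.sub hρ).comp huc hbij.mapsTo)
    equation := fun t ht => by rw [(hflux' t ht).deriv, (hu t ht).deriv]; ring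
    tendsto_left := hu₁.mono_right nhdsWithin_le_nhds
    tendsto_right := hu₀.mono_right nhdsWithin_le_nhds
    flux_left := (neg_zero (G := ℝ) ▸ (hw.tendsto_one.comp hu₁).neg).congr'
      (hflux.eventuallyEq_of_mem (openInterval_mem_rightOf hαβ))
    flux_right := (neg_zero (G := ℝ) ▸ (hw.tendsto_zero.comp hu₀).neg).congr'
      (hflux.eventuallyEq_of_mem (openInterval_mem_leftOf hαβ)) }

end IsConnectingProfile

theorem admissibleSpeed_iff_mem_connectingSpeeds {p c : ℝ} {f g d ρ : ℝ → ℝ} (hp : 1 < p)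
    (hf : ContinuousOn f (Ioo 0 1)) (hg : ContinuousOn g (Ioo 0 1))
    (hρc : ContinuousOn ρ (Ioo 0 1)) (hdc : ContinuousOn d (Ioo 0 1))
    (hρ : ∀ x ∈ Ioo (0 : ℝ) 1, 0 < ρ x) (hd : ∀ x ∈ Ioo (0 : ℝ) 1, 0 < d x) :
    AdmissibleSpeed p f g d ρ c ↔
      c ∈ connectingSpeeds (1 / (p - 1)) f g fun x => ρ x * d x ^ (1 / (p - 1)) := by
  refine ⟨fun ⟨α, β, u, hu⟩ => hu.exists_isConnectingProfile hp hρ hd, fun ⟨w, hw⟩ => ?_⟩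
  have hquot : ∀ x ∈ Ioo (0 : ℝ) 1, 0 < w x / d x := fun x hx =>
    div_pos (hw.isProfileOn x hx).1 (hd x hx)
  obtain ⟨α, β, u, hαβ, hbij, hu⟩ := exists_bijOn_openInterval_hasDerivAt_neg zero_lt_one
    ((hw.isProfileOn.continuousOn.div hdc fun x hx => (hd x hx).ne').rpow_const
      fun x hx => .inl (hquot x hx).ne')
    fun x hx => Real.rpow_pos_of_pos (hquot x hx) (1 / (p - 1))
  exact ⟨α, β, u, hw.isTravellingWave hp hf hg hρc hdc hd hαβ hbij hu⟩

theorem isBigO_rpow_of_tendsto_mul_div {a b : ℝ → ℝ} {s l : ℝ}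
    (h : Tendsto (fun u => a u * (b u / u ^ s)) (𝓝[>] 0) (𝓝 l)) :
    (fun u => a u * b u) =O[𝓝[>] 0] fun u => u ^ s := by
  have hne : ∀ᶠ u : ℝ in 𝓝[>] 0, u ^ s = 0 → a u * b u = 0 :=
    eventually_nhdsWithin_of_forall fun u hu h₀ => absurd h₀ (Real.rpow_pos_of_pos hu s).ne'
  refine Asymptotics.isBigO_of_div_tendsto_nhds hne l (h.congr fun u => ?_)
  rw [Pi.div_apply, mul_div_assoc]

section ConnectingSpeedCriteria

variable {p k δ : ℝ} {f g d ρ : ℝ → ℝ}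

theorem notMem_connectingSpeeds_of_le {r : ℝ} {q : ℝ → ℝ} (hδ : δ ∈ Ioc (0 : ℝ) 1)
    (hq : ∀ u ∈ Ioo (0 : ℝ) 1, 0 < q u) (hle : ∀ u ∈ Ioo 0 δ, k * g u ≤ f u) :
    k ∉ connectingSpeeds r f g q := by
  rintro ⟨w, hw⟩
  have hsub : Ioo 0 δ ⊆ Ioo (0 : ℝ) 1 := Ioo_subset_Ioo_right hδ.2
  obtain ⟨x, hx, hpos⟩ :=
    (hw.isProfileOn.mono hsub).exists_pos hδ.1 (fun u hu => hq u (hsub hu)) hw.tendsto_zero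
  linarith [hle x hx]

theorem mem_connectingSpeeds_of_le_rpow_mul_integral (hp : 1 < p)
    (hf : ContinuousOn f (Icc 0 1)) (hg : ContinuousOn g (Icc 0 1))
    (hρc : ContinuousOn ρ (Ioo 0 1)) (hdc : ContinuousOn d (Ioo 0 1))
    (hρ : ∀ u ∈ Ioo (0 : ℝ) 1, 0 < ρ u) (hd : ∀ u ∈ Ioo (0 : ℝ) 1, 0 < d u)
    (hqi : IntegrableOn (fun u => ρ u * d u ^ (1 / (p - 1))) (Ioo 0 1))
    (hle : ∀ u ∈ Ioo (0 : ℝ) 1, f u ≤ k * g u ∧ p ^ p / (p - 1) ^ (p - 1) * d u * ρ u ^ (p - 1) ≤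
      (k * g u - f u) ^ (p - 1) * ∫ s in (0 : ℝ)..u, (k * g s - f s)) :
    k ∈ connectingSpeeds (1 / (p - 1)) f g fun u => ρ u * d u ^ (1 / (p - 1)) := by
  have hh : ContinuousOn (fun u => k * g u - f u) (Icc 0 1) := (continuousOn_const.mul hg).sub hf
  have hhi := (hh.integrableOn_Icc (μ := volume)).mono_set Ioo_subset_Icc_self
  refine exists_isConnectingProfile (one_div_pos.2 (sub_pos.2 hp)) hh
    (hρc.mul (hdc.rpow_const fun u hu => .inl (hd u hu).ne'))
    (fun u hu => mul_pos (hρ u hu) (Real.rpow_pos_of_pos (hd u hu) _)) hqi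
    (isSubprofileOn_mul_integral_of_rpow_le hp (hh.mono Ioo_subset_Icc_self) hhi hd hρ
      (fun u hu => sub_nonneg.2 (hle u hu).1) fun u hu => (hle u hu).2) ?_
  simpa only [mul_zero] using (tendsto_integral_nhdsGT zero_lt_one hhi).const_mul _

theorem notMem_connectingSpeeds_of_rpow_mul_integral_le {l : ℝ} (hp : 1 < p)
    (hf : ContinuousOn f (Icc 0 1)) (hg : ContinuousOn g (Icc 0 1))
    (hρ : ∀ u ∈ Ioo (0 : ℝ) 1, 0 < ρ u) (hd : ∀ u ∈ Ioo (0 : ℝ) 1, 0 < d u)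
    (hl : l < p ^ p / (p - 1) ^ (p - 1)) (hδ : δ ∈ Ioc (0 : ℝ) 1)
    (hle : ∀ u ∈ Ioo 0 δ, f u ≤ k * g u ∧
      (k * g u - f u) ^ (p - 1) * (∫ s in (0 : ℝ)..u, (k * g s - f s)) ≤ l * d u * ρ u ^ (p - 1)) :
    k ∉ connectingSpeeds (1 / (p - 1)) f g fun u => ρ u * d u ^ (1 / (p - 1)) := by
  rintro ⟨w, hw⟩
  have hsub : Ioo 0 δ ⊆ Ioo (0 : ℝ) 1 := Ioo_subset_Ioo_right hδ.2
  have hh : ContinuousOn (fun u => k * g u - f u) (Icc 0 1) := (continuousOn_const.mul hg).sub hf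
  exact hl.not_ge ((hw.isProfileOn.mono hsub).le_of_rpow_mul_integral_le hp hδ.1
    (hh.mono (hsub.trans Ioo_subset_Icc_self))
    ((hh.integrableOn_Icc (μ := volume)).mono_set (hsub.trans Ioo_subset_Icc_self))
    (fun u hu => hd u (hsub hu)) (fun u hu => hρ u (hsub hu))
    (fun u hu => sub_nonneg.2 (hle u hu).1) (fun u hu => (hle u hu).2) hw.tendsto_zero)

end ConnectingSpeedCriteria

theorem theorem4p2_general (p : ℝ) (hp : 1 < p) (f g d ρ : ℝ → ℝ)
    (hf : ContinuousOn f (Icc 0 1)) (hg : ContinuousOn g (Icc 0 1))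
    (hρ : ContinuousOn ρ (Ioo 0 1)) (hd : ContinuousOn d (Ioo 0 1))
    (hρ_pos : ∀ u ∈ Ioo (0 : ℝ) 1, 0 < ρ u)
    (hg_zero : 0 < g 0) (hg_int : ∀ u ∈ Ioc (0 : ℝ) 1, 0 < ∫ s in (0 : ℝ)..u, g s)
    (hd_pos : ∀ u ∈ Ioo (0 : ℝ) 1, 0 < d u)
    (hd_int : IntegrableOn (fun u => ρ u * d u ^ (1 / (p - 1))) (Ioo 0 1))
    (hO : (fun u => ρ u * d u ^ (1 / (p - 1))) =O[𝓝[>] 0] fun u => u ^ (1 / (p - 1)))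
    (k : ℝ) :
    (∀ c : ℝ, AdmissibleSpeed p f g d ρ c ↔ thresholdSpeed p f g d ρ ≤ c) ∧
    ((∃ δ ∈ Ioc (0 : ℝ) 1, ∀ u ∈ Ioo 0 δ, k * g u ≤ f u) → k < thresholdSpeed p f g d ρ) ∧
    ((∀ u ∈ Ioo (0 : ℝ) 1, f u ≤ k * g u ∧
        p ^ p / (p - 1) ^ (p - 1) * d u * ρ u ^ (p - 1) ≤
          (k * g u - f u) ^ (p - 1) * ∫ s in (0 : ℝ)..u, (k * g s - f s)) →
      thresholdSpeed p f g d ρ ≤ k) ∧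
    ((∃ l : ℝ, l < p ^ p / (p - 1) ^ (p - 1) ∧ ∃ δ ∈ Ioc (0 : ℝ) 1, ∀ u ∈ Ioo 0 δ,
        f u ≤ k * g u ∧
        (k * g u - f u) ^ (p - 1) * (∫ s in (0 : ℝ)..u, (k * g s - f s)) ≤
          l * d u * ρ u ^ (p - 1)) →
      k < thresholdSpeed p f g d ρ) := by
  have hr : 0 < 1 / (p - 1) := one_div_pos.2 (sub_pos.2 hp)
  have hq : ∀ u ∈ Ioo (0 : ℝ) 1, 0 < ρ u * d u ^ (1 / (p - 1)) := fun u hu =>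
    mul_pos (hρ_pos u hu) (Real.rpow_pos_of_pos (hd_pos u hu) _)
  have hqc : ContinuousOn (fun u => ρ u * d u ^ (1 / (p - 1))) (Ioo 0 1) :=
    hρ.mul (hd.rpow_const fun u hu => .inl (hd_pos u hu).ne')
  have hmem (c : ℝ) := admissibleSpeed_iff_mem_connectingSpeeds (c := c) hp
    (hf.mono Ioo_subset_Icc_self) (hg.mono Ioo_subset_Icc_self) hρ hd hρ_pos hd_pos
  have hset : {c | AdmissibleSpeed p f g d ρ c} = connectingSpeeds (1 / (p - 1)) f g
      fun u => ρ u * d u ^ (1 / (p - 1)) := Set.ext hmem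
  have hIci := connectingSpeeds_eq_Ici hr hf hg hg_zero hg_int hqc hq hd_int hO
  have hthreshold (c : ℝ) : AdmissibleSpeed p f g d ρ c ↔ thresholdSpeed p f g d ρ ≤ c := by
    rw [hmem, thresholdSpeed, hset]
    exact Set.ext_iff.1 hIci c
  refine ⟨hthreshold, ?_, fun hk => (hthreshold k).1 ((hmem k).2 ?_), ?_⟩
  · rintro ⟨δ, hδ, hfg⟩
    rw [← not_le, ← hthreshold, hmem]
    exact notMem_connectingSpeeds_of_le hδ hq hfg
  · exact mem_connectingSpeeds_of_le_rpow_mul_integral hp hf hg hρ hd hρ_pos hd_pos hd_int hk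
  · rintro ⟨l, hl, δ, hδ, hle⟩
    rw [← not_le, ← hthreshold, hmem]
    exact notMem_connectingSpeeds_of_rpow_mul_integral_le hp hf hg hρ_pos hd_pos hl hδ hle

theorem theorem4p2 (p : ℝ) (hp : 1 < p) (f g d ρ : ℝ → ℝ)
    (hf : ContinuousOn f (Icc 0 1)) (hg : ContinuousOn g (Icc 0 1))
    (hρ : ContinuousOn ρ (Icc 0 1)) (hd : ContDiffOn ℝ 1 d (Ioo 0 1))
    (hρ_pos : ∀ u ∈ Ioo (0 : ℝ) 1, 0 < ρ u) (hρ_zero : ρ 0 = 0) (hρ_one : ρ 1 = 0)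
    (hg_zero : 0 < g 0) (hg_int : ∀ u ∈ Ioc (0 : ℝ) 1, 0 < ∫ s in (0 : ℝ)..u, g s)
    (hd_pos : ∀ u ∈ Ioo (0 : ℝ) 1, 0 < d u)
    (hd_int : IntegrableOn (fun u => ρ u * d u ^ (1 / (p - 1))) (Ioo 0 1))
    (hl : ∃ l₀ : ℝ, Tendsto (fun u => ρ u * (d u ^ (1 / (p - 1)) / u ^ (1 / (p - 1))))
      (𝓝[>] 0) (𝓝 l₀))
    (k : ℝ) :
    -- `c*` is indeed the threshold between inadmissible and admissible speeds
    (∀ c : ℝ, AdmissibleSpeed p f g d ρ c ↔ thresholdSpeed p f g d ρ ≤ c) ∧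
    -- (a)
    ((∃ δ ∈ Ioc (0 : ℝ) 1, ∀ u ∈ Ioo 0 δ, k * g u ≤ f u) → k < thresholdSpeed p f g d ρ) ∧
    -- (b)
    ((∀ u ∈ Ioo (0 : ℝ) 1, f u ≤ k * g u ∧
        p ^ p / (p - 1) ^ (p - 1) * d u * ρ u ^ (p - 1) ≤
          (k * g u - f u) ^ (p - 1) * ∫ s in (0 : ℝ)..u, (k * g s - f s)) →
      thresholdSpeed p f g d ρ ≤ k) ∧
    -- (c)
    ((∃ l : ℝ, l < p ^ p / (p - 1) ^ (p - 1) ∧ ∃ δ ∈ Ioc (0 : ℝ) 1, ∀ u ∈ Ioo 0 δ,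
        f u ≤ k * g u ∧
        (k * g u - f u) ^ (p - 1) * (∫ s in (0 : ℝ)..u, (k * g s - f s)) ≤
          l * d u * ρ u ^ (p - 1)) →
      k < thresholdSpeed p f g d ρ) := by
  exact theorem4p2_general p hp f g d ρ hf hg (hρ.mono Ioo_subset_Icc_self) hd.continuousOn hρ_pos
    hg_zero hg_int hd_pos hd_int (isBigO_rpow_of_tendsto_mul_div hl.choose_spec) k
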